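/- Let $\mathbb T^1=\mathbb R/\mathbb Z$ and $\mathbb T^2=\mathbb R^2/\mathbb Z^2$, let $f:\mathbb T^2\to\mathbb T^2$ be a homeomorphism (not necessarily homotopic to the identity) and let $F:\mathbb R^2\to\mathbb R^2$ be a lift of $f$. Let $\alpha\in\mathbb R\setminus\mathbb Q$ and assume the following. 1. $f$ is nonwandering: for every nonempty open $U\subseteq\mathbb T^2$ there is $n\ge 1$ with $f^n(U)\cap U\neq\emptyset$. 2. $f$ is non-annular, that is, no iterate $f^k$ with $k\geq 1$ is annular; here a homeomorphism $g$ of $\mathbb T^2$ is called annular if there exist $M>0$, a vector $v\in\mathbb Z^2\setminus\{0\}$ and a lift $G$ of $g$ such that $|\langle G^n(z)-z,v\rangle|<M$ for all $n\in\mathbb N$ and $z\in\mathbb R^2$. 3. The rotation set $\rho(F)=\bigcap_{n\in\mathbb N}\overline{\bigcup_{m\ge n}\{(F^m(z)-z)/m : z\in\mathbb R^2\}}$ is contained in $\{\alpha\}\times\mathbb R$. 4. $f$ has bounded deviations in the direction of $v=(1,0)$: there are $a\in\mathbb R$ and $C>0$ such that $\bigcap_{n\in\mathbb N}\overline{\bigcup_{m\geq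 n}\{\langle F^m(z)-z,v\rangle/m : z\in\mathbb R^2\}}=\{a\}$ and $|\langle F^n(z)-z,v\rangle-na|\le C$ for all $n\in\mathbb N$ and $z\in\mathbb R^2$. 5. No iterate $f^k$ with $k\ge 1$ is a pseudo-rotation with uniformly bounded deviations; here a homeomorphism $g$ of $\mathbb T^2$ is called a pseudo-rotation with uniformly bounded deviations if it is homotopic to the identity and there exist a lift $G$ of $g$, a vector $\rho\in\mathbb R^2$ and $C>0$ such that $\|G^n(z)-z-n\rho\|\le C$ for all $n\in\mathbb N$ and $z\in\mathbb R^2$. Then $f$ is semiconjugate to the irrational rotation $R_\alpha:x\mapsto x+\alpha$ on $\mathbb T^1$: there is a continuous surjective map $h:\mathbb T^2\to\mathbb T^1$ with $h\circ f=R_\alpha\circ h$. -/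

import Mathlib

open Set Topology

namespace TorusRotationFactor

/-- The circle `ℝ / ℤ`. -/
abbrev T1 : Type := UnitAddCircle

/-- The two-torus `ℝ² / ℤ²`. -/
abbrev T2 : Type := UnitAddCircle × UnitAddCircle

/-- The universal covering projection `ℝ² → 𝕋²`. -/
def proj (z : ℝ × ℝ) : T2 := ((z.1 : UnitAddCircle), (z.2 : UnitAddCircle))

/-- The standard scalar product on the plane. -/
def dot (u v : ℝ × ℝ) : ℝ := u.1 * v.1 + u.2 * v.2

/-- `F` is a lift of the torus homeomorphism `f` to the universal covering. -/
def IsLift (F : ℝ × ℝ → ℝ × ℝ) (f : T2 ≃ₜ T2) : Prop :=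
  Continuous F ∧ ∀ z, proj (F z) = f (proj z)

/-- Every nonempty open set meets one of its forward images under a positive iterate. -/
def IsNonwandering (f : T2 ≃ₜ T2) : Prop :=
  ∀ U : Set T2, IsOpen U → U.Nonempty → ∃ n : ℕ, 1 ≤ n ∧ ((f ^ n) '' U ∩ U).Nonempty

/-- Some lift has uniformly bounded displacement in the direction of a nonzero integer vector. -/
def IsAnnular (f : T2 ≃ₜ T2) : Prop :=
  ∃ (M : ℝ) (p q : ℤ) (F : ℝ × ℝ → ℝ × ℝ), 0 < M ∧ (p, q) ≠ (0, 0) ∧ IsLift F f ∧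
    ∀ (n : ℕ) (z : ℝ × ℝ), |dot (F^[n] z - z) ((p : ℝ), (q : ℝ))| < M

/-- Some positive iterate is annular. -/
def IsEventuallyAnnular (f : T2 ≃ₜ T2) : Prop :=
  ∃ k : ℕ, 1 ≤ k ∧ IsAnnular (f ^ k)

/-- The (Misiurewicz–Ziemian) rotation set of `F`: all limits of
`(F^{mᵢ}(zᵢ) - zᵢ) / mᵢ` with `mᵢ → ∞` and `zᵢ ∈ ℝ²`. -/
def rotationSet (F : ℝ × ℝ → ℝ × ℝ) : Set (ℝ × ℝ) :=
  ⋂ n : ℕ, closure (⋃ m ≥ n, range fun z : ℝ × ℝ => (m : ℝ)⁻¹ • (F^[m] z - z))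

/-- The rotation interval of `F` in the direction of `v`. -/
def rotationInterval (F : ℝ × ℝ → ℝ × ℝ) (v : ℝ × ℝ) : Set ℝ :=
  ⋂ n : ℕ, closure (⋃ m ≥ n, range fun z : ℝ × ℝ => dot (F^[m] z - z) v / m)

/-- Bounded deviations from a constant rotation in the direction of `v`. -/
def HasBoundedDeviations (F : ℝ × ℝ → ℝ × ℝ) (v : ℝ × ℝ) : Prop :=
  ∃ a : ℝ, rotationInterval F v = {a} ∧
    ∃ C : ℝ, 0 < C ∧ ∀ (n : ℕ) (z : ℝ × ℝ), |dot (F^[n] z - z) v - n * a| ≤ C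

/-- `f` is homotopic to the identity and stays, after lifting, at bounded distance from the
orbits of a translation. As `C` is existentially quantified, it does not matter that the norm
of `ℝ × ℝ` is the maximum norm rather than the Euclidean one. -/
def IsPseudoRotationBdd (f : T2 ≃ₜ T2) : Prop :=
  ContinuousMap.Homotopic (f : C(T2, T2)) (ContinuousMap.id T2) ∧
    ∃ (F : ℝ × ℝ → ℝ × ℝ) (ρ : ℝ × ℝ) (C : ℝ), IsLift F f ∧ 0 < C ∧
      ∀ (n : ℕ) (z : ℝ × ℝ), ‖F^[n] z - z - (n : ℝ) • ρ‖ ≤ C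

/-- There is a continuous surjection `h : 𝕋² → 𝕋¹` with `h ∘ f = R_α ∘ h`, where `R_α` is the
rotation of the circle by `α`. -/
def IsSemiconjugateToRotation (f : T2 ≃ₜ T2) (α : ℝ) : Prop :=
  ∃ h : T2 → T1, Continuous h ∧ Function.Surjective h ∧
    Function.Semiconj h f (fun x : T1 => x + (α : T1))

end TorusRotationFactor

/-!
By hypothesis the orbits of the lift `Φ` move to the right with speed `α`, up to a bounded error.
Following them in the frame moving with this speed, consider the set of points whose orbit gets
to the right of `r`, and let `leftSet Φ α C r` be the component containing a left half-plane of
the complement of the closure of that set. The level of `z` is the infimum of the `s` with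
`z ∈ leftSet Φ α C s`; it increases by `α` under `Φ` and by `m` under the deck translation by
`(m, k)`.

If every strip between two levels contains a path joining a point to one of its nontrivial
vertical integer translates, then these periodic curves separate the plane, the level is a
continuous function, and it descends to a semiconjugacy to the rotation.

Otherwise no thin strip contains such a path. By recurrence some `g = (T_v Φⁿ)²`, which acts on
the deck group by a shear and shifts the level by a small nonzero amount, maps a compact connected
subset `K` of a thin strip to a set meeting `K`. The union `Γ` of the translates `gʲ K` crosses all
levels. Above a given level, `Γ` meets `Γ + (m, k)` for only one `k`, since two such crossings
would produce a vertical periodic path in a thin strip. This forces the shear to be trivial and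
the oscillation of `Γ` to be bounded, so that the vertical displacement of `gʲ` is the same at all
points up to a bounded error. Quasi-additivity then gives `g` a rotation vector with bounded
deviations, which is excluded.
-/

namespace TorusRotationFactor

section Crossing

theorem lt_of_cos_neg_of_cos_pos {X : Type*} [TopologicalSpace X] [PreconnectedSpace X]
    {u : X → ℝ} (hu : Continuous u) (hsin : ∀ x, 0 < Real.sin (u x)) {x y : X}
    (hx : Real.cos (u x) < 0) (hy : 0 < Real.cos (u y)) : u y < u x := by
  by_contra! hle
  have sin_pos : ∀ a ∈ Icc (u x) (u y), 0 < Real.sin a := fun a ha => by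
    obtain ⟨t, rfl⟩ := mem_range_of_exists_le_of_exists_ge hu ⟨x, ha.1⟩ ⟨y, ha.2⟩
    exact hsin t
  have cos_anti : AntitoneOn Real.cos (Icc (u x) (u y)) :=
    antitoneOn_of_deriv_nonpos (convex_Icc _ _) Real.continuous_cos.continuousOn
      Real.differentiable_cos.differentiableOn fun a ha => by
        rw [Real.deriv_cos]
        exact (neg_neg_of_pos (sin_pos a (interior_subset ha))).le
  exact (hx.trans hy).not_ge (cos_anti (left_mem_Icc.2 hle) (right_mem_Icc.2 hle) hle)

theorem exists_continuous_angle {X : Type*} [TopologicalSpace X] [SimplyConnectedSpace X]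
    [LocallyPathConnectedSpace X] {D : X → ℂ} (hD : Continuous D) (h0 : ∀ x, D x ≠ 0) :
    ∃ θ : X → ℝ, Continuous θ ∧
      ∀ x, (D x).re = ‖D x‖ * Real.cos (θ x) ∧ (D x).im = ‖D x‖ * Real.sin (θ x) := by
  obtain ⟨x₀⟩ : Nonempty X := inferInstance
  obtain ⟨w, ⟨-, hw⟩, -⟩ := Complex.isCoveringMapOn_exp.existsUnique_continuousMap_lifts
    ⟨D, hD⟩ (Complex.exp_log (h0 x₀)) h0
  refine ⟨fun x => (w x).im, by fun_prop, fun x => ?_⟩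
  have hwx : D x = Complex.exp (w x) := (congrFun hw x).symm
  rw [hwx, Complex.norm_exp]
  exact ⟨Complex.exp_re _, Complex.exp_im _⟩

/-- The planar Poincaré–Miranda theorem: without a common zero, the angle of `(u, v)` would decrease
along each of the four sides of the box, traversed in cyclic order. -/
theorem exists_common_zero {u v : ℝ × ℝ → ℝ} (hu : Continuous u) (hv : Continuous v)
    {x₀ x₁ y₀ y₁ : ℝ} (left : ∀ y, u (x₀, y) < 0) (right : ∀ y, 0 < u (x₁, y))
    (bottom : ∀ x, 0 < v (x, y₀)) (top : ∀ x, v (x, y₁) < 0) : ∃ q, u q = 0 ∧ v q = 0 := by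
  by_contra! hne
  let D : ℝ × ℝ → ℂ := fun q => Complex.equivRealProdCLM.symm (u q, v q)
  have hD0 : ∀ q, D q ≠ 0 := fun q h =>
    hne q (congrArg Complex.re h) (congrArg Complex.im h)
  obtain ⟨θ, hθ, hpolar⟩ := exists_continuous_angle (D := D) (by fun_prop) hD0
  have hnorm : ∀ q, 0 < ‖D q‖ := fun q => norm_pos_iff.2 (hD0 q)
  have hcos : ∀ q, u q = ‖D q‖ * Real.cos (θ q) := fun q => (hpolar q).1
  have hsin : ∀ q, v q = ‖D q‖ * Real.sin (θ q) := fun q => (hpolar q).2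
  have cos_left : ∀ y, Real.cos (θ (x₀, y)) < 0 := fun y =>
    neg_of_mul_neg_right (hcos _ ▸ left y) (hnorm _).le
  have cos_right : ∀ y, 0 < Real.cos (θ (x₁, y)) := fun y =>
    pos_of_mul_pos_right (hcos _ ▸ right y) (hnorm _).le
  have sin_bottom : ∀ x, 0 < Real.sin (θ (x, y₀)) := fun x =>
    pos_of_mul_pos_right (hsin _ ▸ bottom x) (hnorm _).le
  have sin_top : ∀ x, Real.sin (θ (x, y₁)) < 0 := fun x =>
    neg_of_mul_neg_right (hsin _ ▸ top x) (hnorm _).le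
  have h₁ : θ (x₁, y₀) < θ (x₀, y₀) :=
    lt_of_cos_neg_of_cos_pos (u := fun x => θ (x, y₀)) (by fun_prop) sin_bottom
      (cos_left y₀) (cos_right y₀)
  have h₂ : θ (x₁, y₁) + Real.pi / 2 < θ (x₁, y₀) + Real.pi / 2 :=
    lt_of_cos_neg_of_cos_pos (u := fun y => θ (x₁, y) + Real.pi / 2) (by fun_prop)
      (by simpa [Real.sin_add_pi_div_two] using cos_right)
      (by simpa [Real.cos_add_pi_div_two] using sin_bottom x₁)
      (by simpa [Real.cos_add_pi_div_two] using sin_top x₁)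
  have h₃ : θ (x₀, y₁) + Real.pi < θ (x₁, y₁) + Real.pi :=
    lt_of_cos_neg_of_cos_pos (u := fun x => θ (x, y₁) + Real.pi) (by fun_prop)
      (by simpa using sin_top) (by simpa using cos_right y₁) (by simpa using cos_left y₁)
  have h₄ : θ (x₀, y₀) - Real.pi / 2 < θ (x₀, y₁) - Real.pi / 2 :=
    lt_of_cos_neg_of_cos_pos (u := fun y => θ (x₀, y) - Real.pi / 2) (by fun_prop)
      (by simpa [Real.sin_sub_pi_div_two] using cos_left)
      (by simpa [Real.cos_sub_pi_div_two] using sin_top x₀)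
      (by simpa [Real.cos_sub_pi_div_two] using sin_bottom x₀)
  linarith

theorem paths_cross {a₀ a₁ b₀ b₁ : ℝ × ℝ} (a : Path a₀ a₁) (b : Path b₀ b₁)
    (hl : ∀ s, a₀.1 < (b s).1) (hr : ∀ s, (b s).1 < a₁.1)
    (hb : ∀ t, b₀.2 < (a t).2) (ht : ∀ t, (a t).2 < b₁.2) : ∃ t s, a t = b s := by
  have extend_eq : ∀ {x y : ℝ × ℝ} (p : Path x y) (t : ℝ), ∃ s, p s = p.extend t :=
    fun p t => (p.extend_range ▸ mem_range_self t : p.extend t ∈ range p)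
  obtain ⟨⟨t, s⟩, h₁, h₂⟩ := exists_common_zero (x₀ := 0) (x₁ := 1) (y₀ := 0) (y₁ := 1)
    (u := fun q => (a.extend q.1).1 - (b.extend q.2).1)
    (v := fun q => (a.extend q.1).2 - (b.extend q.2).2) (by fun_prop) (by fun_prop)
    (fun s => by
      obtain ⟨s', hs'⟩ := extend_eq b s
      simpa [← hs'] using hl s')
    (fun s => by
      obtain ⟨s', hs'⟩ := extend_eq b s
      simpa [← hs'] using hr s')
    (fun t => by
      obtain ⟨t', ht'⟩ := extend_eq a t
      simpa [← ht'] using hb t')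
    (fun t => by
      obtain ⟨t', ht'⟩ := extend_eq a t
      simpa [← ht'] using ht t')
  obtain ⟨t', ht'⟩ := extend_eq a t
  obtain ⟨s', hs'⟩ := extend_eq b s
  refine ⟨t', s', ?_⟩
  rw [ht', hs']
  exact Prod.ext (sub_eq_zero.1 h₁) (sub_eq_zero.1 h₂)

theorem joinedIn_vertical {S : Set (ℝ × ℝ)} {x y y' : ℝ}
    (h : ∀ t ∈ uIcc y y', (x, t) ∈ S) : JoinedIn S (x, y) (x, y') := by
  have hpc : IsPathConnected (uIcc y y') := (convex_uIcc y y').isPathConnected nonempty_uIcc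
  exact ((hpc.joinedIn y left_mem_uIcc y' right_mem_uIcc).map
    (f := fun t : ℝ => (x, t)) (by fun_prop)).mono (image_subset_iff.2 h)

/-- The path in `Y` is prolonged by a downward and an upward vertical ray, which do not meet `X`. -/
theorem joinedIn_cross {X Y : Set (ℝ × ℝ)} {a₀ a₁ b₀ b₁ : ℝ × ℝ} {l r : ℝ}
    (hX : JoinedIn X a₀ a₁) (hY : JoinedIn Y b₀ b₁)
    (hl : a₀.1 < l) (hr : r < a₁.1) (hYlr : ∀ z ∈ Y, z.1 ∈ Icc l r)
    (hb : ∀ z ∈ X, z.1 = b₀.1 → b₀.2 < z.2)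
    (ht : ∀ z ∈ X, z.1 = b₁.1 → z.2 < b₁.2) : (X ∩ Y).Nonempty := by
  let a := hX.somePath
  obtain ⟨M, hM⟩ : ∃ M : ℝ, ∀ t, |(a t).2| ≤ M := by
    obtain ⟨M, hM⟩ := (isCompact_range (f := fun t => |(a t).2|) (by fun_prop)).bddAbove
    exact ⟨M, fun t => hM ⟨t, rfl⟩⟩
  let lo := min b₀.2 (-M - 1)
  let hi := max b₁.2 (M + 1)
  let Z : Set (ℝ × ℝ) := Y ∪ ({z | z.1 = b₀.1 ∧ z.2 ≤ b₀.2} ∪ {z | z.1 = b₁.1 ∧ b₁.2 ≤ z.2})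
  have below : JoinedIn Z (b₀.1, lo) b₀ := joinedIn_vertical fun t ht =>
    Or.inr (Or.inl ⟨rfl, (uIcc_of_le (min_le_left b₀.2 (-M - 1)) ▸ ht).2⟩)
  have above : JoinedIn Z b₁ (b₁.1, hi) := joinedIn_vertical fun t ht =>
    Or.inr (Or.inr ⟨rfl, (uIcc_of_le (le_max_left b₁.2 (M + 1)) ▸ ht).1⟩)
  have b := (below.trans (hY.mono subset_union_left)).trans above
  have hZ : ∀ z ∈ Z, z.1 ∈ Icc l r := by
    rintro z (hz | ⟨hz, -⟩ | ⟨hz, -⟩)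
    · exact hYlr z hz
    · exact hz ▸ hYlr _ hY.source_mem
    · exact hz ▸ hYlr _ hY.target_mem
  obtain ⟨t, s, hts⟩ := paths_cross a b.somePath
    (fun s => hl.trans_le (hZ _ (b.somePath_mem s)).1)
    (fun s => (hZ _ (b.somePath_mem s)).2.trans_lt hr)
    (fun t => (min_le_right _ _).trans_lt (by linarith [(abs_le.1 (hM t)).1]))
    (fun t => lt_of_lt_of_le (by linarith [(abs_le.1 (hM t)).2]) (le_max_right _ _))
  have hx : a t ∈ X := hX.somePath_mem t
  have hz : a t ∈ Z := hts ▸ b.somePath_mem s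
  rcases hz with hz | ⟨hz₁, hz₂⟩ | ⟨hz₁, hz₂⟩
  · exact ⟨a t, hx, hz⟩
  · exact absurd (hb _ hx hz₁) hz₂.not_gt
  · exact absurd (ht _ hx hz₁) hz₂.not_gt

end Crossing

section DeckTransformations

/-- The inclusion `ℤ² → ℝ²`, whose values are the deck translations of the torus. -/
def lattice : ℤ × ℤ →+ ℝ × ℝ :=
  (Int.castAddHom ℝ).prodMap (Int.castAddHom ℝ)

@[simp]
theorem lattice_fst (v : ℤ × ℤ) : (lattice v).1 = v.1 := rfl

@[simp]
theorem lattice_snd (v : ℤ × ℤ) : (lattice v).2 = v.2 := rfl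

/-- The plane homeomorphism `Ψ` intertwines deck translations through the automorphism `A` of
`ℤ²`. For a lift of a torus homeomorphism, `A` is its action on the fundamental group. -/
def IsDeckEquivariant (Ψ : (ℝ × ℝ) ≃ₜ (ℝ × ℝ)) (A : (ℤ × ℤ) ≃ₗ[ℤ] (ℤ × ℤ)) : Prop :=
  ∀ z v, Ψ (z + lattice v) = Ψ z + lattice (A v)

variable {Ψ Ψ' : (ℝ × ℝ) ≃ₜ (ℝ × ℝ)} {A B : (ℤ × ℤ) ≃ₗ[ℤ] (ℤ × ℤ)}

theorem IsDeckEquivariant.one : IsDeckEquivariant 1 1 := fun _ _ => rfl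

theorem IsDeckEquivariant.mul (h : IsDeckEquivariant Ψ A) (h' : IsDeckEquivariant Ψ' B) :
    IsDeckEquivariant (Ψ * Ψ') (A * B) := fun z v => by
  simp only [Homeomorph.mul_apply, h' z v, h (Ψ' z), LinearEquiv.mul_apply]

theorem IsDeckEquivariant.inv (h : IsDeckEquivariant Ψ A) : IsDeckEquivariant Ψ⁻¹ A⁻¹ :=
  fun z v => by
    rw [Homeomorph.inv_apply, Homeomorph.inv_apply, Homeomorph.symm_apply_eq, h,
      Homeomorph.apply_symm_apply, ← LinearEquiv.mul_apply, mul_inv_cancel, LinearEquiv.coe_one, id]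

theorem IsDeckEquivariant.zpow (h : IsDeckEquivariant Ψ A) (n : ℤ) :
    IsDeckEquivariant (Ψ ^ n) (A ^ n) := by
  induction n with
  | zero => exact IsDeckEquivariant.one
  | succ n ih => simpa only [zpow_add_one] using ih.mul h
  | pred n ih => simpa only [zpow_sub_one] using ih.mul h.inv

theorem isDeckEquivariant_addRight (w : ℝ × ℝ) : IsDeckEquivariant (Homeomorph.addRight w) 1 :=
  fun z v => add_right_comm z (lattice v) w

theorem int_eq_zero_of_forall_mul_le {d : ℤ} {B : ℝ} (h : ∀ n : ℕ, (n : ℝ) * |(d : ℝ)| ≤ B) :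
    d = 0 := by
  by_contra hd
  obtain ⟨n, hn⟩ := exists_nat_gt B
  have hd' : (1 : ℝ) ≤ |(d : ℝ)| := mod_cast Int.one_le_abs hd
  exact hn.not_ge ((le_mul_of_one_le_right n.cast_nonneg hd').trans (h n))

theorem IsDeckEquivariant.fst_apply (h : IsDeckEquivariant Ψ A) {t B : ℝ}
    (hB : ∀ z, |(Ψ z).1 - z.1 - t| ≤ B) (v : ℤ × ℤ) : (A v).1 = v.1 := by
  refine sub_eq_zero.1 (int_eq_zero_of_forall_mul_le (B := B + B) fun n => ?_)
  have h₁ := hB (0 + lattice (n • v))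
  rw [h, map_nsmul] at h₁
  refine le_trans (le_of_eq ?_) ((abs_sub _ _).trans (add_le_add h₁ (hB 0)))
  rw [← Nat.abs_cast n, ← abs_mul]
  simp only [Int.cast_sub, mul_sub, nsmul_eq_mul, Prod.fst_add, lattice_fst, Prod.fst_mul,
    Prod.fst_natCast, Int.cast_mul, Int.cast_natCast, zero_add, Prod.fst_zero, sub_zero,
    sub_sub_sub_cancel_right]
  ring_nf

end DeckTransformations

section Levels

/-- All iterates of `Φ` have horizontal deviation at most `C` from the translation by `α`. -/
def HasHorizontalBound (Φ : (ℝ × ℝ) ≃ₜ (ℝ × ℝ)) (α C : ℝ) : Prop :=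
  ∀ (n : ℤ) (z : ℝ × ℝ), |((Φ ^ n) z).1 - z.1 - n * α| ≤ C

/-- The points whose orbit under `Φ`, seen in the frame moving with speed `α`, passes to the right
of `r`. It approximates a half plane by a set that `Φ` moves rigidly. -/
def rightSet (Φ : (ℝ × ℝ) ≃ₜ (ℝ × ℝ)) (α r : ℝ) : Set (ℝ × ℝ) :=
  {z | ∃ n : ℤ, r < ((Φ ^ n) z).1 - n * α}

/-- The component of the exterior of `rightSet Φ α r` that contains a left half plane. The base
point is chosen for maps with horizontal deviation at most `C`. -/
def leftSet (Φ : (ℝ × ℝ) ≃ₜ (ℝ × ℝ)) (α C r : ℝ) : Set (ℝ × ℝ) :=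
  connectedComponentIn (closure (rightSet Φ α r))ᶜ (r - C - 1, 0)

/-- The open region between the boundaries at levels `r` and `s`. -/
def strip (Φ : (ℝ × ℝ) ≃ₜ (ℝ × ℝ)) (α C r s : ℝ) : Set (ℝ × ℝ) :=
  leftSet Φ α C s ∩ rightSet Φ α r

/-- The homeomorphism `Ψ` raises the level of the sets `rightSet Φ α r` by `t`. -/
def IsShift (Φ : (ℝ × ℝ) ≃ₜ (ℝ × ℝ)) (α : ℝ) (Ψ : (ℝ × ℝ) ≃ₜ (ℝ × ℝ)) (t : ℝ) : Prop :=
  ∀ r z, z ∈ rightSet Φ α r ↔ Ψ z ∈ rightSet Φ α (r + t)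

variable {Φ Ψ Ψ' : (ℝ × ℝ) ≃ₜ (ℝ × ℝ)} {A : (ℤ × ℤ) ≃ₗ[ℤ] (ℤ × ℤ)} {α C t t' r s : ℝ} {z : ℝ × ℝ}

theorem HasHorizontalBound.nonneg (hb : HasHorizontalBound Φ α C) : 0 ≤ C :=
  (abs_nonneg _).trans (hb 0 0)

theorem IsShift.one : IsShift Φ α 1 0 := fun r z => by simp

theorem IsShift.mul (h : IsShift Φ α Ψ t) (h' : IsShift Φ α Ψ' t') :
    IsShift Φ α (Ψ * Ψ') (t + t') := fun r z => by
  rw [h' r z, h (r + t') (Ψ' z), Homeomorph.mul_apply, add_assoc, add_comm t' t]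

theorem IsShift.inv (h : IsShift Φ α Ψ t) : IsShift Φ α Ψ⁻¹ (-t) := fun r z => by
  rw [h (r + -t) (Ψ⁻¹ z), Homeomorph.inv_apply, Homeomorph.apply_symm_apply,
    neg_add_cancel_right]

theorem IsShift.zpow (h : IsShift Φ α Ψ t) (n : ℤ) : IsShift Φ α (Ψ ^ n) (n * t) := by
  induction n with
  | zero => simpa using IsShift.one
  | succ n ih => simpa only [zpow_add_one, Int.cast_add, Int.cast_one, add_one_mul] using ih.mul h
  | pred n ih =>
    simpa only [zpow_sub_one, Int.cast_sub, Int.cast_one, sub_one_mul, ← sub_eq_add_neg]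
      using ih.mul h.inv

theorem isShift_self : IsShift Φ α Φ α := fun r z => by
  refine (Equiv.subRight (1 : ℤ)).exists_congr fun n => ?_
  rw [Equiv.subRight_apply, ← Homeomorph.mul_apply, ← zpow_add_one, sub_add_cancel, Int.cast_sub,
    Int.cast_one, sub_one_mul]
  constructor <;> intro h <;> linarith

theorem isShift_addRight_lattice (hb : HasHorizontalBound Φ α C) (hΦ : IsDeckEquivariant Φ A)
    (v : ℤ × ℤ) : IsShift Φ α (Homeomorph.addRight (lattice v)) v.1 := fun r z => by
  refine exists_congr fun n => ?_
  rw [Homeomorph.coe_addRight, hΦ.zpow n, Prod.fst_add, lattice_fst,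
    (hΦ.zpow n).fst_apply (hb n)]
  constructor <;> intro h <;> linarith

theorem isOpen_rightSet (r : ℝ) : IsOpen (rightSet Φ α r) := by
  simp only [rightSet, ofPred_exists]
  exact isOpen_iUnion fun n => isOpen_lt (by fun_prop) (by fun_prop)

theorem rightSet_anti (h : r ≤ s) : rightSet Φ α s ⊆ rightSet Φ α r :=
  fun _ ⟨n, hn⟩ => ⟨n, h.trans_lt hn⟩

theorem mem_rightSet_of_lt (h : r < z.1) : z ∈ rightSet Φ α r :=
  ⟨0, by simpa using h⟩

theorem lt_of_mem_rightSet (hb : HasHorizontalBound Φ α C) (h : z ∈ rightSet Φ α r) :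
    r - C < z.1 := by
  obtain ⟨n, hn⟩ := h
  linarith [(abs_le.1 (hb n z)).2]

theorem le_of_mem_closure_rightSet (hb : HasHorizontalBound Φ α C)
    (h : z ∈ closure (rightSet Φ α r)) : r - C ≤ z.1 :=
  closure_minimal (fun _ hw => (lt_of_mem_rightSet hb hw).le)
    (isClosed_le continuous_const continuous_fst) h

theorem IsShift.abs_fst_le (hb : HasHorizontalBound Φ α C) (h : IsShift Φ α Ψ t) (z : ℝ × ℝ) :
    |(Ψ z).1 - z.1 - t| ≤ C := by
  refine abs_le.2 ⟨le_of_forall_pos_lt_add fun ε hε => ?_, le_of_forall_pos_lt_add fun ε hε => ?_⟩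
  · linarith [lt_of_mem_rightSet hb ((h (z.1 - ε) z).1 (mem_rightSet_of_lt (by linarith)))]
  · linarith [lt_of_mem_rightSet hb
      ((h ((Ψ z).1 - t - ε) z).2 (mem_rightSet_of_lt (by linarith)))]

theorem isPathConnected_rightSet (hb : HasHorizontalBound Φ α C) (r : ℝ) :
    IsPathConnected (rightSet Φ α r) := by
  refine (isOpen_rightSet r).isConnected_iff_isPathConnected.1
    ⟨⟨(r + 1, 0), mem_rightSet_of_lt (by simp)⟩, ?_⟩
  have eq_iUnion : rightSet Φ α r = ⋃ n : ℤ, (Φ ^ n) ⁻¹' {z | r + n * α < z.1} := by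
    ext z; simp [rightSet, lt_sub_iff_add_lt]
  rw [eq_iUnion]
  refine isPreconnected_iUnion ⟨(r + C + 1, 0), mem_iInter.2 fun n => ?_⟩ fun n => ?_
  · have := (abs_le.1 (hb n (r + C + 1, 0))).1
    simp only [mem_preimage, mem_ofPred_eq]
    linarith
  · rw [Homeomorph.isPreconnected_preimage]
    exact (convex_halfSpace_gt (IsLinearMap.mk (fun _ _ => rfl) (fun _ _ => rfl)) _).isPreconnected

theorem notMem_closure_rightSet_of_lt (hb : HasHorizontalBound Φ α C) (hz : z.1 < r - C) :
    z ∈ (closure (rightSet Φ α r))ᶜ :=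
  fun h => (le_of_mem_closure_rightSet hb h).not_gt hz

theorem mem_leftSet_of_lt (hb : HasHorizontalBound Φ α C) (hz : z.1 < r - C) :
    z ∈ leftSet Φ α C r := by
  have hc : Convex ℝ {z : ℝ × ℝ | z.1 < r - C} :=
    convex_halfSpace_lt (IsLinearMap.mk (fun _ _ => rfl) (fun _ _ => rfl)) _
  exact hc.isPreconnected.subset_connectedComponentIn (x := (r - C - 1, 0)) (by simp)
    (fun w hw => notMem_closure_rightSet_of_lt hb hw) hz

theorem leftSet_eq (hb : HasHorizontalBound Φ α C) (hz : z.1 < r - C) :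
    leftSet Φ α C r = connectedComponentIn (closure (rightSet Φ α r))ᶜ z :=
  connectedComponentIn_eq (mem_leftSet_of_lt hb hz)

theorem isOpen_leftSet (r : ℝ) : IsOpen (leftSet Φ α C r) :=
  isClosed_closure.isOpen_compl.connectedComponentIn

theorem isPathConnected_leftSet (hb : HasHorizontalBound Φ α C) (r : ℝ) :
    IsPathConnected (leftSet Φ α C r) :=
  (isOpen_leftSet r).isConnected_iff_isPathConnected.1
    (isConnected_connectedComponentIn_iff.2 (notMem_closure_rightSet_of_lt hb (by simp)))

theorem notMem_rightSet_of_mem_leftSet (hz : z ∈ leftSet Φ α C r) : z ∉ rightSet Φ α r :=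
  fun h => connectedComponentIn_subset _ _ hz (subset_closure h)

theorem le_of_mem_leftSet (hz : z ∈ leftSet Φ α C r) : z.1 ≤ r :=
  not_lt.1 fun h => notMem_rightSet_of_mem_leftSet hz (mem_rightSet_of_lt h)

theorem leftSet_mono (hb : HasHorizontalBound Φ α C) (h : r ≤ s) :
    leftSet Φ α C r ⊆ leftSet Φ α C s := by
  rw [leftSet_eq hb (r := s) (z := (r - C - 1, 0)) (by simp only; linarith)]
  exact connectedComponentIn_mono _ (compl_subset_compl.2 (closure_mono (rightSet_anti h)))

theorem lt_of_mem_strip (hz : z ∈ strip Φ α C r s) : r < s :=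
  not_le.1 fun h => notMem_rightSet_of_mem_leftSet hz.1 (rightSet_anti h hz.2)

theorem frontier_leftSet_subset : frontier (leftSet Φ α C r) ⊆ closure (rightSet Φ α r) := by
  intro z hz
  by_contra hn
  obtain ⟨w, hw, hw'⟩ := mem_closure_iff.1 hz.1 _
    isClosed_closure.isOpen_compl.connectedComponentIn (mem_connectedComponentIn hn)
  have hleft : leftSet Φ α C r = connectedComponentIn (closure (rightSet Φ α r))ᶜ z :=
    (connectedComponentIn_eq hw').trans (connectedComponentIn_eq hw).symm
  rw [(isOpen_leftSet r).frontier_eq] at hz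
  exact hz.2 (hleft ▸ mem_connectedComponentIn hn)

theorem IsShift.mem_leftSet_iff (hb : HasHorizontalBound Φ α C) (h : IsShift Φ α Ψ t) (r : ℝ)
    (z : ℝ × ℝ) : z ∈ leftSet Φ α C r ↔ Ψ z ∈ leftSet Φ α C (r + t) := by
  have himage : Ψ '' (closure (rightSet Φ α r))ᶜ = (closure (rightSet Φ α (r + t)))ᶜ := by
    have hpre : Ψ ⁻¹' rightSet Φ α (r + t) = rightSet Φ α r := ext fun w => (h r w).symm
    rw [image_compl_eq Ψ.bijective, Ψ.image_closure, ← hpre, Ψ.image_preimage]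
  have hC := hb.nonneg
  have hz : ((r - 2 * C - 1, 0) : ℝ × ℝ).1 < r - C := by simp only; linarith
  have hΨz : (Ψ (r - 2 * C - 1, 0)).1 < r + t - C := by
    linarith [(abs_le.1 (h.abs_fst_le hb (r - 2 * C - 1, 0))).2]
  rw [leftSet_eq hb hz, leftSet_eq hb hΨz, ← himage,
    ← Ψ.image_connectedComponentIn (notMem_closure_rightSet_of_lt hb hz),
    Ψ.injective.mem_set_image]

theorem IsShift.mem_strip_iff (hb : HasHorizontalBound Φ α C) (h : IsShift Φ α Ψ t) (r s : ℝ)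
    (z : ℝ × ℝ) : z ∈ strip Φ α C r s ↔ Ψ z ∈ strip Φ α C (r + t) (s + t) :=
  and_congr (h.mem_leftSet_iff hb s z) (h r z)

theorem strip_mono (hb : HasHorizontalBound Φ α C) {r' s' : ℝ} (hr : r' ≤ r) (hs : s ≤ s') :
    strip Φ α C r s ⊆ strip Φ α C r' s' :=
  inter_subset_inter (leftSet_mono hb hs) (rightSet_anti hr)

theorem isOpen_strip (r s : ℝ) : IsOpen (strip Φ α C r s) :=
  (isOpen_leftSet s).inter (isOpen_rightSet r)

theorem exists_int_mul_add_mem_Ioo (hα : Irrational α) {x y : ℝ} (hxy : x < y) :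
    ∃ n m : ℤ, n * α + m ∈ Ioo x y := by
  have hd : Dense (AddSubgroup.closure {α, 1} : Set ℝ) :=
    dense_addSubgroupClosure_pair_iff.2 (by simpa using hα)
  obtain ⟨z, hz, hz'⟩ := hd.exists_mem_open isOpen_Ioo (nonempty_Ioo.2 hxy)
  obtain ⟨n, m, rfl⟩ := AddSubgroup.mem_closure_pair.1 hz
  exact ⟨n, m, by simpa using hz'⟩

theorem exists_isShift (hb : HasHorizontalBound Φ α C) (hΦ : IsDeckEquivariant Φ A)
    (hα : Irrational α) {x y : ℝ} (hxy : x < y) :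
    ∃ t ∈ Ioo x y, ∃ Ψ B, IsDeckEquivariant Ψ B ∧ IsShift Φ α Ψ t := by
  obtain ⟨n, m, h⟩ := exists_int_mul_add_mem_Ioo hα hxy
  exact ⟨_, h, _, _, (hΦ.zpow n).mul (isDeckEquivariant_addRight _),
    (isShift_self.zpow n).mul (isShift_addRight_lattice hb hΦ (m, 0))⟩

/-- Otherwise the shifts would carry the inclusion to all levels, and by iteration every point
would lie in a fixed `leftSet`. -/
theorem not_leftSet_subset (hb : HasHorizontalBound Φ α C) (hΦ : IsDeckEquivariant Φ A)
    (hα : Irrational α) (hrs : r < s) : ¬ leftSet Φ α C s ⊆ leftSet Φ α C r := by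
  intro hsub
  obtain ⟨δ, hδ, hδs⟩ : ∃ δ, 0 < δ ∧ δ + δ = s - r := ⟨(s - r) / 2, by linarith, by ring⟩
  have step : ∀ u, leftSet Φ α C (u + δ) ⊆ leftSet Φ α C u := fun u z hz => by
    obtain ⟨t, ⟨ht₁, ht₂⟩, Ψ, -, -, hΨ⟩ := exists_isShift (x := r - u) (y := r - u + δ) hb hΦ hα
      (by linarith)
    rw [hΨ.mem_leftSet_iff hb] at hz ⊢
    exact leftSet_mono hb (by linarith) (hsub (leftSet_mono hb (by linarith) hz))
  have iterate : ∀ k : ℕ, leftSet Φ α C (k * δ) ⊆ leftSet Φ α C 0 := fun k => by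
    induction k with
    | zero => simp
    | succ k ih => exact (by simpa only [Nat.cast_succ, add_one_mul] using step (k * δ) :
        leftSet Φ α C ((k + 1 : ℕ) * δ) ⊆ leftSet Φ α C (k * δ)).trans ih
  obtain ⟨k, hk⟩ := exists_nat_gt ((C + 1) / δ)
  rw [div_lt_iff₀ hδ] at hk
  have h10 : ((1, 0) : ℝ × ℝ) ∈ leftSet Φ α C (k * δ) :=
    mem_leftSet_of_lt hb (by simp only; linarith)
  exact zero_lt_one.not_ge (le_of_mem_leftSet (iterate k h10))

theorem strip_nonempty (hb : HasHorizontalBound Φ α C) (hΦ : IsDeckEquivariant Φ A)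
    (hα : Irrational α) (hrs : r < s) : (strip Φ α C r s).Nonempty := by
  by_contra hne
  have hdisj : Disjoint (leftSet Φ α C s) (closure (rightSet Φ α r)) :=
    (disjoint_iff_inter_eq_empty.2 (not_nonempty_iff_eq_empty.1 hne)).closure_right
      (isOpen_leftSet s)
  exact not_leftSet_subset hb hΦ hα hrs <|
    (isPathConnected_leftSet hb s).isConnected.isPreconnected.subset_connectedComponentIn
      (mem_leftSet_of_lt hb (by simp only; linarith)) fun _ hw => hdisj.notMem_of_mem_left hw

end Levels

section EssentialCurves

/-- The set `S` contains a curve that projects to a closed curve of nonzero vertical homotopy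
class in the torus. -/
def HasEssentialCurve (S : Set (ℝ × ℝ)) : Prop :=
  ∃ (p : ℝ × ℝ) (l : ℤ), l ≠ 0 ∧ JoinedIn S p (p + lattice (0, l))

/-- The union of the translates of `K` by the vectors `(0, k)` with `k` an integer. -/
def verticalSaturation (K : Set (ℝ × ℝ)) : Set (ℝ × ℝ) :=
  {z | ∃ k : ℤ, z + lattice (0, k) ∈ K}

variable {S T K X : Set (ℝ × ℝ)}

theorem HasEssentialCurve.mono (hST : S ⊆ T) :
    HasEssentialCurve S → HasEssentialCurve T := fun ⟨p, l, hl, h⟩ => ⟨p, l, hl, h.mono hST⟩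

theorem HasEssentialCurve.exists_isCompact (h : HasEssentialCurve S) :
    ∃ K ⊆ S, IsCompact K ∧ HasEssentialCurve K := by
  obtain ⟨p, l, hl, hj⟩ := h
  exact ⟨range hj.somePath, range_subset_iff.2 hj.somePath_mem,
    isCompact_range hj.somePath.continuous, p, l, hl, hj.somePath, mem_range_self⟩

theorem isClosed_verticalSaturation (hK : IsCompact K) : IsClosed (verticalSaturation K) := by
  have hZ : IsClosed ({0} ×ˢ range ((↑) : ℤ → ℝ) : Set (ℝ × ℝ)) :=
    isClosed_singleton.prod Int.isClosedEmbedding_coe_real.isClosed_range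
  convert hZ.add_right_of_isCompact hK using 1
  ext z
  constructor
  · rintro ⟨k, hk⟩
    exact ⟨lattice (0, -k), ⟨by simp, -k, rfl⟩, _, hk, by ext <;> simp⟩
  · rintro ⟨⟨_, _⟩, ⟨rfl, k, rfl⟩, w, hw, rfl⟩
    exact ⟨-k, by convert hw using 1; ext <;> simp⟩

theorem subset_verticalSaturation (K : Set (ℝ × ℝ)) : K ⊆ verticalSaturation K :=
  fun z hz => ⟨0, by rwa [Prod.mk_zero_zero, map_zero, add_zero]⟩

theorem add_mem_verticalSaturation {z : ℝ × ℝ} (hz : z ∈ verticalSaturation K) (k : ℤ) :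
    z + lattice (0, k) ∈ verticalSaturation K := by
  obtain ⟨j, hj⟩ := hz
  exact ⟨j - k, by convert hj using 1; ext <;> simp⟩

theorem joinedIn_add {p q v : ℝ × ℝ} (h : JoinedIn S p q) (hS : ∀ z ∈ S, z + v ∈ T) :
    JoinedIn T (p + v) (q + v) :=
  (h.map (f := fun z => z + v) (by fun_prop)).mono (image_subset_iff.2 hS)

theorem exists_lt_int_mul {η : ℝ} (hη : η ≠ 0) (x : ℝ) : ∃ n : ℤ, x < n * η := by
  rcases hη.lt_or_gt with hη | hη
  · obtain ⟨n, hn⟩ := exists_int_lt (x / η)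
    exact ⟨n, (lt_div_iff_of_neg hη).1 hn⟩
  · obtain ⟨n, hn⟩ := exists_int_gt (x / η)
    exact ⟨n, (div_lt_iff₀ hη).1 hn⟩

theorem HasEssentialCurve.exists_joinedIn (h : HasEssentialCurve S)
    (hS : ∀ z ∈ S, ∀ k : ℤ, z + lattice (0, k) ∈ S) (M : ℝ) :
    ∃ b₀ b₁, JoinedIn S b₀ b₁ ∧ b₀.2 < -M ∧ M < b₁.2 := by
  obtain ⟨p, l, hl, hp⟩ := h
  have step : ∀ n : ℤ, JoinedIn S (p + lattice (0, n * l)) (p + lattice (0, (n + 1) * l)) :=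
    fun n => by
      have h := joinedIn_add hp (fun z hz => hS z hz (n * l))
      rwa [add_assoc, ← map_add, show ((0, l) : ℤ × ℤ) + (0, n * l) = (0, (n + 1) * l) from
        Prod.ext (add_zero 0) (by simp only [Prod.snd_add]; ring)] at h
  have multiple : ∀ n : ℤ, JoinedIn S p (p + lattice (0, n * l)) := fun n => by
    induction n with
    | zero => simpa [Prod.mk_zero_zero] using JoinedIn.refl hp.source_mem
    | succ n ih => exact ih.trans (step n)
    | pred n ih => exact ih.trans (by simpa using (step (-n - 1)).symm)
  obtain ⟨m, hm⟩ := exists_lt_int_mul (neg_ne_zero.2 (Int.cast_ne_zero.2 hl)) (M + p.2)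
  obtain ⟨n, hn⟩ := exists_lt_int_mul (Int.cast_ne_zero.2 hl) (M - p.2)
  refine ⟨_, _, (multiple m).symm.trans (multiple n), ?_, ?_⟩ <;>
    simp only [Prod.snd_add, lattice_snd, Int.cast_mul] <;> linarith

theorem HasEssentialCurve.inter_nonempty (h : HasEssentialCurve S)
    (hS : ∀ z ∈ S, ∀ k : ℤ, z + lattice (0, k) ∈ S) {l r : ℝ} (hlr : ∀ z ∈ S, z.1 ∈ Icc l r)
    {a₀ a₁ : ℝ × ℝ} (hX : JoinedIn X a₀ a₁) (h₀ : a₀.1 < l) (h₁ : r < a₁.1) :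
    (X ∩ S).Nonempty := by
  let a := hX.somePath
  obtain ⟨M, hM⟩ := (isCompact_range (f := fun t => |(a t).2|) (by fun_prop)).bddAbove
  have hM' : ∀ t, |(a t).2| ≤ M := fun t => hM ⟨t, rfl⟩
  obtain ⟨b₀, b₁, hb, hb₀, hb₁⟩ := h.exists_joinedIn hS M
  obtain ⟨w, ⟨t, rfl⟩, hw⟩ := joinedIn_cross (X := range a) ⟨a, mem_range_self⟩ hb h₀ h₁ hlr
    (by rintro _ ⟨t, rfl⟩ -; exact hb₀.trans_le (abs_le.1 (hM' t)).1)
    (by rintro _ ⟨t, rfl⟩ -; exact (abs_le.1 (hM' t)).2.trans_lt hb₁)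
  exact ⟨a t, hX.somePath_mem t, hw⟩

end EssentialCurves

section LevelFunction

variable {Φ Ψ : (ℝ × ℝ) ≃ₜ (ℝ × ℝ)} {A : (ℤ × ℤ) ≃ₗ[ℤ] (ℤ × ℤ)} {α C t r s : ℝ} {z : ℝ × ℝ}

/-- The level of a point with respect to the increasing family `leftSet Φ α C`. It is the lift of
the semiconjugacy whenever it is continuous. -/
noncomputable def level (Φ : (ℝ × ℝ) ≃ₜ (ℝ × ℝ)) (α C : ℝ) (z : ℝ × ℝ) : ℝ :=
  sInf {s | z ∈ leftSet Φ α C s}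

theorem level_le_of_mem_leftSet (h : z ∈ leftSet Φ α C s) : level Φ α C z ≤ s :=
  csInf_le ⟨z.1, fun _ => le_of_mem_leftSet⟩ h

theorem mem_leftSet_of_level_lt (hb : HasHorizontalBound Φ α C) (h : level Φ α C z < s) :
    z ∈ leftSet Φ α C s := by
  have hne : {s | z ∈ leftSet Φ α C s}.Nonempty :=
    ⟨z.1 + C + 1, mem_leftSet_of_lt hb (by linarith)⟩
  obtain ⟨s', hz, hs'⟩ := exists_lt_of_csInf_lt hne h
  exact leftSet_mono hb hs'.le hz

theorem IsShift.level_apply (hb : HasHorizontalBound Φ α C) (h : IsShift Φ α Ψ t) (z : ℝ × ℝ) :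
    level Φ α C (Ψ z) = level Φ α C z + t := by
  have apply_le : ∀ {Ψ : (ℝ × ℝ) ≃ₜ (ℝ × ℝ)} {t : ℝ}, IsShift Φ α Ψ t → ∀ z,
      level Φ α C (Ψ z) ≤ level Φ α C z + t := fun {Ψ t} h z =>
    le_of_forall_pos_le_add fun ε hε => by
      rw [add_right_comm]
      exact level_le_of_mem_leftSet ((h.mem_leftSet_iff hb _ z).1
        (mem_leftSet_of_level_lt hb (lt_add_of_pos_right _ hε)))
  refine (apply_le h z).antisymm ?_
  have hinv := apply_le h.inv (Ψ z)
  rw [Homeomorph.inv_apply, Homeomorph.symm_apply_apply] at hinv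
  linarith

theorem inter_rightSet_nonempty {B : Set (ℝ × ℝ)} (hBo : IsOpen B) (hB : IsPreconnected B)
    (hl : (B ∩ leftSet Φ α C r).Nonempty) (hn : ¬ B ⊆ leftSet Φ α C r) :
    (B ∩ rightSet Φ α r).Nonempty := by
  obtain ⟨v, ⟨hv, hvB⟩, hv'⟩ := not_subset.1 fun h =>
    hn (hB.subset_of_closure_inter_subset (isOpen_leftSet r) hl h)
  have hfr : v ∈ frontier (leftSet Φ α C r) := (isOpen_leftSet r).frontier_eq ▸ ⟨hv, hv'⟩
  exact mem_closure_iff.1 (frontier_leftSet_subset hfr) _ hBo hvB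

theorem inter_nonempty_of_subset_strip (hb : HasHorizontalBound Φ α C) {S B : Set (ℝ × ℝ)}
    (hS : HasEssentialCurve S) (hadd : ∀ z ∈ S, ∀ k : ℤ, z + lattice (0, k) ∈ S)
    (hsub : S ⊆ strip Φ α C r s) (hB : IsPathConnected B)
    (hl : (B ∩ leftSet Φ α C r).Nonempty) (hr : (B ∩ rightSet Φ α s).Nonempty) :
    (B ∩ S).Nonempty := by
  obtain ⟨u, huB, hu⟩ := hl
  obtain ⟨w, hwB, hw⟩ := hr
  have h₀ : (r - C - 1, 0) ∈ leftSet Φ α C r := mem_leftSet_of_lt hb (by simp)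
  have h₁ : (s + 1, 0) ∈ rightSet Φ α s := mem_rightSet_of_lt (by simp)
  have hX : JoinedIn (leftSet Φ α C r ∪ B ∪ rightSet Φ α s) (r - C - 1, 0) (s + 1, 0) :=
    ((((isPathConnected_leftSet hb r).joinedIn _ h₀ _ hu).mono
        (subset_union_left.trans subset_union_left)).trans
      ((hB.joinedIn _ huB _ hwB).mono (subset_union_right.trans subset_union_left))).trans
      (((isPathConnected_rightSet hb s).joinedIn _ hw _ h₁).mono subset_union_right)
  obtain ⟨v, (hv | hv) | hv, hvS⟩ := hS.inter_nonempty hadd (l := r - C) (r := s)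
    (fun z hz => ⟨(lt_of_mem_rightSet hb (hsub hz).2).le, le_of_mem_leftSet (hsub hz).1⟩) hX
    (by simp) (by simp)
  · exact absurd (hsub hvS).2 (notMem_rightSet_of_mem_leftSet hv)
  · exact ⟨v, hv, hvS⟩
  · exact absurd hv (notMem_rightSet_of_mem_leftSet (hsub hvS).1)

theorem mem_strip_add_iff (hb : HasHorizontalBound Φ α C) (hΦ : IsDeckEquivariant Φ A) (k : ℤ) :
    z + lattice (0, k) ∈ strip Φ α C r s ↔ z ∈ strip Φ α C r s := by
  simpa using ((isShift_addRight_lattice (α := α) hb hΦ (0, k)).mem_strip_iff hb r s z).symm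

/-- A small disc reaching from `leftSet Φ α C r` to the complement of `leftSet Φ α C t` would
connect the two sides of an essential curve in between without meeting it. -/
theorem closure_leftSet_subset (hb : HasHorizontalBound Φ α C) (hΦ : IsDeckEquivariant Φ A)
    (hess : ∀ r s, r < s → HasEssentialCurve (strip Φ α C r s)) (hrt : r < t) :
    closure (leftSet Φ α C r) ⊆ leftSet Φ α C t := by
  intro z hcl
  by_contra hz
  obtain ⟨K, hKsub, hK, hKess⟩ := (hess r t hrt).exists_isCompact
  have hsat : verticalSaturation K ⊆ strip Φ α C r t := fun w ⟨k, hk⟩ =>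
    (mem_strip_add_iff hb hΦ k).1 (hKsub hk)
  obtain ⟨ε, hε, hball⟩ := Metric.isOpen_iff.1 (isClosed_verticalSaturation hK).isOpen_compl z
    fun h => hz (hsat h).1
  have hB : IsPathConnected (Metric.ball z ε) :=
    (convex_ball z ε).isPathConnected ⟨z, Metric.mem_ball_self hε⟩
  obtain ⟨u, huB, hu⟩ := mem_closure_iff.1 hcl _ Metric.isOpen_ball (Metric.mem_ball_self hε)
  have hright : (Metric.ball z ε ∩ rightSet Φ α t).Nonempty :=
    inter_rightSet_nonempty Metric.isOpen_ball hB.isConnected.isPreconnected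
      ⟨u, huB, leftSet_mono hb hrt.le hu⟩ fun h => hz (h (Metric.mem_ball_self hε))
  obtain ⟨v, hvB, hv⟩ := inter_nonempty_of_subset_strip hb
    (hKess.mono (subset_verticalSaturation K)) (fun w hw => add_mem_verticalSaturation hw) hsat hB
    ⟨u, huB, hu⟩ hright
  exact hball hvB hv

theorem continuous_level (hb : HasHorizontalBound Φ α C) (hΦ : IsDeckEquivariant Φ A)
    (hess : ∀ r s, r < s → HasEssentialCurve (strip Φ α C r s)) :
    Continuous (level Φ α C) := by
  refine continuous_iff_continuousAt.2 fun z =>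
    tendsto_order.2 ⟨fun r hr => ?_, fun s hs => ?_⟩
  · obtain ⟨r₁, h₁, hz₁⟩ := exists_between hr
    obtain ⟨r₂, h₂, hz₂⟩ := exists_between hz₁
    have hz : z ∉ closure (leftSet Φ α C r₁) := fun h =>
      (level_le_of_mem_leftSet (closure_leftSet_subset hb hΦ hess h₂ h)).not_gt hz₂
    filter_upwards [isClosed_closure.isOpen_compl.mem_nhds hz] with w hw
    by_contra hle
    exact hw (subset_closure (mem_leftSet_of_level_lt hb ((not_lt.1 hle).trans_lt h₁)))
  · obtain ⟨s', hs', hz⟩ := exists_between hs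
    filter_upwards [(isOpen_leftSet s').mem_nhds (mem_leftSet_of_level_lt hb hs')] with w hw
    exact (level_le_of_mem_leftSet hw).trans_lt hz

end LevelFunction

section Chains

/-- The automorphism `(m, k) ↦ (m, k + c * m)` of `ℤ²`. -/
def shear (c : ℤ) : (ℤ × ℤ) ≃ₗ[ℤ] (ℤ × ℤ) :=
  (LinearEquiv.refl ℤ ℤ).skewProd (LinearEquiv.refl ℤ ℤ) (LinearMap.mulLeft ℤ c)

theorem shear_apply (c m k : ℤ) : shear c (m, k) = (m, k + c * m) := rfl

theorem shear_zero : shear 0 = 1 := LinearEquiv.ext fun ⟨m, k⟩ => by simp [shear_apply]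

theorem shear_zpow (c n : ℤ) : shear c ^ n = shear (n * c) := by
  have shear_mul : ∀ c d, shear c * shear d = shear (c + d) := fun c d =>
    LinearEquiv.ext fun ⟨m, k⟩ => by
      simp only [LinearEquiv.mul_apply, shear_apply]
      ring_nf
  have shear_inv : ∀ c, (shear c)⁻¹ = shear (-c) := fun c =>
    inv_eq_of_mul_eq_one_right (by rw [shear_mul, add_neg_cancel, shear_zero])
  induction n with
  | zero => rw [zpow_zero, zero_mul, shear_zero]
  | succ n ih => rw [zpow_add_one, ih, shear_mul, add_one_mul]
  | pred n ih => rw [zpow_sub_one, ih, shear_inv, shear_mul, sub_one_mul, sub_eq_add_neg]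

/-- The image of `K` under the `j`-th iterate of `g`. -/
def piece (g : (ℝ × ℝ) ≃ₜ (ℝ × ℝ)) (K : Set (ℝ × ℝ)) (j : ℤ) : Set (ℝ × ℝ) := (g ^ j) '' K

/-- The union of all images of `K` under iterates of `g`. -/
def orbitSet (g : (ℝ × ℝ) ≃ₜ (ℝ × ℝ)) (K : Set (ℝ × ℝ)) : Set (ℝ × ℝ) := ⋃ j, piece g K j

/-- A compact path connected set `K` in a thin strip that meets its image under `g`, where `g`
raises levels by the small amount `η`, in a situation where slightly thicker strips contain no
essential curve. Its orbit then behaves like a `g`-invariant line. -/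
structure IsChain (Φ : (ℝ × ℝ) ≃ₜ (ℝ × ℝ)) (α C : ℝ) (g : (ℝ × ℝ) ≃ₜ (ℝ × ℝ)) (η e : ℝ)
    (c : ℤ) (K : Set (ℝ × ℝ)) : Prop where
  bound : HasHorizontalBound Φ α C
  translation : ∀ v, IsShift Φ α (Homeomorph.addRight (lattice v)) v.1
  equivariant : IsDeckEquivariant g (shear c)
  shift : IsShift Φ α g η
  shift_ne : η ≠ 0
  shift_le : |η| ≤ e
  compact : IsCompact K
  pathConnected : IsPathConnected K
  meets : (K ∩ g '' K).Nonempty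
  subset : K ⊆ strip Φ α C (-e) e
  not_essential : ∀ r, ¬ HasEssentialCurve (strip Φ α C (r - 4 * e) (r + 4 * e))

variable {Φ g : (ℝ × ℝ) ≃ₜ (ℝ × ℝ)} {α C η e : ℝ} {c : ℤ} {K : Set (ℝ × ℝ)} {z : ℝ × ℝ}

theorem mem_orbitSet : z ∈ orbitSet g K ↔ ∃ j, z ∈ piece g K j := mem_iUnion

theorem zpow_apply_mem_piece_iff (i j : ℤ) : (g ^ i) z ∈ piece g K (i + j) ↔ z ∈ piece g K j := by
  have image_piece : piece g K (i + j) = (g ^ i) '' piece g K j := by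
    rw [piece, piece, zpow_add, ← image_comp]
    rfl
  rw [image_piece, (g ^ i).injective.mem_set_image]

theorem zpow_apply_mem_orbitSet_iff (i : ℤ) : (g ^ i) z ∈ orbitSet g K ↔ z ∈ orbitSet g K := by
  simp only [mem_orbitSet]
  rw [← (Equiv.addLeft i).exists_congr_right]
  exact exists_congr fun j => zpow_apply_mem_piece_iff i j

theorem int_mul_mem_of_mem_uIcc {S : Set ℝ} (hS : S.OrdConnected) {i j k : ℤ}
    (hk : k ∈ uIcc i j) (hi : i * η ∈ S) (hj : j * η ∈ S) : k * η ∈ S := by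
  refine hS.uIcc_subset hi hj ?_
  rcases le_total 0 η with hη | hη
  · exact ((Int.cast_mono.mul_const hη).monotoneOn _).mapsTo_uIcc hk
  · have hanti : Antitone fun k : ℤ => (k : ℝ) * η := fun _ _ h =>
      mul_le_mul_of_nonpos_right (Int.cast_mono h) hη
    exact (hanti.antitoneOn _).mapsTo_uIcc hk

namespace IsChain

theorem thickness_nonneg (h : IsChain Φ α C g η e c K) : 0 ≤ e :=
  (abs_nonneg _).trans h.shift_le

theorem piece_subset_strip (h : IsChain Φ α C g η e c K) (j : ℤ) :
    piece g K j ⊆ strip Φ α C (j * η - e) (j * η + e) := by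
  rintro _ ⟨w, hw, rfl⟩
  convert ((h.shift.zpow j).mem_strip_iff h.bound _ _ w).1 (h.subset hw) using 2 <;> ring

theorem abs_fst_le (h : IsChain Φ α C g η e c K) {j : ℤ} (hz : z ∈ piece g K j) :
    |z.1 - j * η| ≤ e + C := by
  obtain ⟨hleft, hright⟩ := h.piece_subset_strip j hz
  have := lt_of_mem_rightSet h.bound hright
  exact abs_le.2 ⟨by linarith, by linarith [le_of_mem_leftSet hleft, h.bound.nonneg]⟩

theorem zpow_apply_add_lattice (h : IsChain Φ α C g η e c K) (j m k : ℤ) (z : ℝ × ℝ) :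
    (g ^ j) (z + lattice (m, k)) = (g ^ j) z + lattice (m, k + j * c * m) := by
  rw [h.equivariant.zpow, shear_zpow, shear_apply]

theorem joinedIn_succ (h : IsChain Φ α C g η e c K) {j : ℤ} {x y : ℝ × ℝ}
    (hx : x ∈ piece g K j) (hy : y ∈ piece g K (j + 1)) :
    JoinedIn (piece g K j ∪ piece g K (j + 1)) x y := by
  have hpc : ∀ k, IsPathConnected (piece g K k) := fun k =>
    h.pathConnected.image (g ^ k).continuous
  refine ((hpc j).union (hpc (j + 1)) ?_).joinedIn _ (.inl hx) _ (.inr hy)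
  obtain ⟨w, hw, u, hu, huw⟩ := h.meets
  exact ⟨(g ^ j) w, mem_image_of_mem _ hw, u, hu, by rw [zpow_add_one, Homeomorph.mul_apply, huw]⟩

theorem joinedIn_of_le (h : IsChain Φ α C g η e c K) {i j : ℤ} (hij : i ≤ j) {x y : ℝ × ℝ}
    (hx : x ∈ piece g K i) (hy : y ∈ piece g K j) :
    JoinedIn {z | ∃ k ∈ Icc i j, z ∈ piece g K k} x y := by
  induction j, hij using Int.leInduction generalizing y with
  | base =>
    exact ((h.pathConnected.image (g ^ i).continuous).joinedIn _ hx _ hy).mono fun z hz =>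
      ⟨i, ⟨le_rfl, le_rfl⟩, hz⟩
  | succ j hij ih =>
    obtain ⟨w, hw⟩ := h.pathConnected.nonempty.image (g ^ j)
    refine ((ih hw).mono ?_).trans ((h.joinedIn_succ hw hy).mono ?_)
    · exact fun z ⟨k, hk, hz⟩ => ⟨k, Icc_subset_Icc_right (by lia) hk, hz⟩
    · rintro z (hz | hz)
      exacts [⟨j, ⟨hij, by lia⟩, hz⟩, ⟨j + 1, ⟨by lia, le_rfl⟩, hz⟩]

theorem joinedIn (h : IsChain Φ α C g η e c K) {i j : ℤ} {x y : ℝ × ℝ}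
    (hx : x ∈ piece g K i) (hy : y ∈ piece g K j) :
    JoinedIn {z | ∃ k ∈ uIcc i j, z ∈ piece g K k} x y := by
  rcases le_total i j with hij | hij
  · simpa only [uIcc_of_le hij] using h.joinedIn_of_le hij hx hy
  · simpa only [uIcc_of_ge hij] using (h.joinedIn_of_le hij hy hx).symm

theorem joinedIn_orbitSet (h : IsChain Φ α C g η e c K) {x y : ℝ × ℝ}
    (hx : x ∈ orbitSet g K) (hy : y ∈ orbitSet g K) : JoinedIn (orbitSet g K) x y := by
  obtain ⟨i, hi⟩ := mem_orbitSet.1 hx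
  obtain ⟨j, hj⟩ := mem_orbitSet.1 hy
  exact (h.joinedIn hi hj).mono fun z ⟨k, _, hz⟩ => mem_orbitSet.2 ⟨k, hz⟩

theorem exists_abs_snd_le (h : IsChain Φ α C g η e c K) (R : ℝ) :
    ∃ b, ∀ z ∈ orbitSet g K, |z.1| ≤ R → |z.2| ≤ b := by
  have hη : 0 < |η| := abs_pos.2 h.shift_ne
  obtain ⟨N, hN⟩ := exists_nat_gt ((R + (e + C)) / |η|)
  rw [div_lt_iff₀ hη] at hN
  have hcompact : IsCompact (⋃ j ∈ Icc (-(N : ℤ)) N, piece g K j) :=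
    (finite_Icc _ _).isCompact_biUnion fun j _ => h.compact.image (g ^ j).continuous
  obtain ⟨b, hb⟩ := (hcompact.image (f := fun w : ℝ × ℝ => |w.2|) (by fun_prop)).bddAbove
  refine ⟨b, fun z hz hzR => hb ⟨z, ?_, rfl⟩⟩
  obtain ⟨j, hj⟩ := mem_orbitSet.1 hz
  have hjη : |(j : ℝ)| * |η| < N * |η| := by
    rw [← abs_mul]
    linarith [abs_sub_abs_le_abs_sub (j * η) z.1, abs_sub_comm (j * η) z.1, h.abs_fst_le hj]
  have hjN : |j| ≤ (N : ℤ) := mod_cast (lt_of_mul_lt_mul_right hjη hη.le).le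
  exact mem_biUnion (abs_le.1 hjN) hj

theorem inter_orbitSet_nonempty (h : IsChain Φ α C g η e c K) {Y : Set (ℝ × ℝ)} {u w : ℝ × ℝ}
    (hY : JoinedIn Y u w) (hu : ∀ z ∈ orbitSet g K, z.1 = u.1 → u.2 < z.2)
    (hw : ∀ z ∈ orbitSet g K, z.1 = w.1 → z.2 < w.2) : (orbitSet g K ∩ Y).Nonempty := by
  let y := hY.somePath
  obtain ⟨R, hR⟩ := (isCompact_range (f := fun t => |(y t).1|) (by fun_prop)).bddAbove
  obtain ⟨i, hi⟩ := exists_lt_int_mul (neg_ne_zero.2 h.shift_ne) (R + (e + C))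
  obtain ⟨j, hj⟩ := exists_lt_int_mul h.shift_ne (R + (e + C))
  obtain ⟨a, ha⟩ := h.pathConnected.nonempty.image (g ^ i)
  obtain ⟨a', ha'⟩ := h.pathConnected.nonempty.image (g ^ j)
  obtain ⟨z, hz, t, rfl⟩ := joinedIn_cross (Y := range y) (l := -R) (r := R)
    (h.joinedIn_orbitSet (mem_orbitSet.2 ⟨i, ha⟩) (mem_orbitSet.2 ⟨j, ha'⟩)) ⟨y, mem_range_self⟩
    (by linarith [(abs_le.1 (h.abs_fst_le ha)).2]) (by linarith [(abs_le.1 (h.abs_fst_le ha')).1])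
    (by rintro _ ⟨t, rfl⟩; exact abs_le.1 (hR ⟨t, rfl⟩)) hu hw
  exact ⟨y t, hz, hY.somePath_mem t⟩

theorem mem_strip_of_mem_piece (h : IsChain Φ α C g η e c K) {j : ℤ} {M : ℝ}
    (hz : z ∈ piece g K j) (hj : j * η ∈ Icc (M - 3 * e) (M + 3 * e)) :
    z ∈ strip Φ α C (M - 4 * e) (M + 4 * e) :=
  strip_mono h.bound (by linarith [hj.1]) (by linarith [hj.2]) (h.piece_subset_strip j hz)

theorem add_lattice_mem_strip (h : IsChain Φ α C g η e c K) {r s : ℝ}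
    (hz : z ∈ strip Φ α C r s) (v : ℤ × ℤ) :
    z + lattice v ∈ strip Φ α C (r + v.1) (s + v.1) :=
  ((h.translation v).mem_strip_iff h.bound r s z).1 hz

theorem abs_index_sub_le (h : IsChain Φ α C g η e c K) {i j : ℤ} {v : ℤ × ℤ}
    (hi : z + lattice v ∈ piece g K i) (hj : z ∈ piece g K j) :
    |i * η - (j * η + v.1)| ≤ 2 * e := by
  have hi := h.piece_subset_strip i hi
  have hj := h.add_lattice_mem_strip (h.piece_subset_strip j hj) v
  have h₁ := lt_of_mem_strip ⟨hi.1, hj.2⟩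
  have h₂ := lt_of_mem_strip ⟨hj.1, hi.2⟩
  exact abs_le.2 ⟨by linarith, by linarith⟩

/-- Otherwise an arc of the orbit of `K` and an arc of a translate would together form an essential
curve in a thin strip. -/
theorem crossing_unique (h : IsChain Φ α C g η e c K) {i i' j j' m k k' : ℤ} {x y : ℝ × ℝ}
    (hx : x + lattice (m, k) ∈ piece g K i) (hx' : x ∈ piece g K i')
    (hy : y + lattice (m, k') ∈ piece g K j) (hy' : y ∈ piece g K j')
    (hij : |i' * η - j' * η| ≤ e) : k = k' := by
  by_contra hne
  have he := h.thickness_nonneg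
  obtain ⟨hx₁, hx₂⟩ := abs_le.1 (h.abs_index_sub_le hx hx')
  obtain ⟨hy₁, hy₂⟩ := abs_le.1 (h.abs_index_sub_le hy hy')
  obtain ⟨hij₁, hij₂⟩ := abs_le.1 hij
  simp only at hx₁ hx₂ hy₁ hy₂
  obtain ⟨M, hM⟩ : ∃ M : ℝ, M = i' * η + m := ⟨_, rfl⟩
  have arc : JoinedIn (strip Φ α C (M - 4 * e) (M + 4 * e)) (x + lattice (m, k))
      (y + lattice (m, k')) :=
    (h.joinedIn hx hy).mono fun z ⟨u, hu, hz⟩ => h.mem_strip_of_mem_piece hz <|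
      int_mul_mem_of_mem_uIcc ordConnected_Icc hu ⟨by linarith, by linarith⟩
        ⟨by linarith, by linarith⟩
  have translated_arc : JoinedIn (strip Φ α C (M - 4 * e) (M + 4 * e)) (y + lattice (m, k'))
      (x + lattice (m, k')) := by
    refine joinedIn_add (h.joinedIn hy' hx') fun z ⟨u, hu, hz⟩ => ?_
    have hu' : u * η ∈ Icc (i' * η - 3 * e) (i' * η + 3 * e) :=
      int_mul_mem_of_mem_uIcc ordConnected_Icc hu ⟨by linarith, by linarith⟩
        ⟨by linarith, by linarith⟩
    convert h.add_lattice_mem_strip (h.mem_strip_of_mem_piece hz hu') (m, k') using 2 <;>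
      simp only [hM] <;> ring
  refine h.not_essential M ⟨x + lattice (m, k), k' - k, sub_ne_zero.2 (Ne.symm hne), ?_⟩
  convert arc.trans translated_arc using 1
  ext <;> simp

theorem add_lattice_notMem_orbitSet (h : IsChain Φ α C g η e c K) (hc : c ≠ 0) (k : ℤ)
    (hz : z ∈ orbitSet g K) : z + lattice (1, k) ∉ orbitSet g K := by
  intro hz'
  obtain ⟨i', hi'⟩ := mem_orbitSet.1 hz
  obtain ⟨i, hi⟩ := mem_orbitSet.1 hz'
  have hgi := (zpow_apply_mem_piece_iff 1 i).2 hi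
  rw [h.zpow_apply_add_lattice] at hgi
  have hk := h.crossing_unique hi hi' hgi ((zpow_apply_mem_piece_iff 1 i').2 hi') (by
    push_cast
    rw [add_mul, sub_add_cancel_right, one_mul, abs_neg]
    exact h.shift_le)
  exact hc (by linarith)

/-- A nontrivial shear would carry a translate of the orbit of `K` far below the orbit to one far
above it, although the two translates are joined by a path that avoids the orbit. -/
theorem twist_eq_zero (h : IsChain Φ α C g η e c K) : c = 0 := by
  by_contra hc
  obtain ⟨p, hp⟩ : (orbitSet g K).Nonempty :=
    h.pathConnected.nonempty.mono fun z hz => mem_orbitSet.2 ⟨0, z, hz, rfl⟩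
  obtain ⟨b, hb⟩ := h.exists_abs_snd_le |p.1 + 1|
  obtain ⟨N, hN⟩ := exists_nat_gt (b + |p.2|)
  obtain ⟨hp₁, hp₂⟩ := abs_le.1 (le_refl |p.2|)
  obtain ⟨i, hi⟩ : ∃ i : ℤ, (N : ℤ) ≤ -N - i * c :=
    ⟨-c * (2 * N), by nlinarith [mul_self_pos.2 hc, Int.natCast_nonneg N]⟩
  obtain ⟨b', hb'⟩ := h.exists_abs_snd_le |((g ^ i) p).1 + 1|
  obtain ⟨B, hB⟩ := exists_int_gt (max (N : ℝ) (b' - ((g ^ i) p).2 - i * c))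
  obtain ⟨hBN, hBb'⟩ := max_lt_iff.1 hB
  have horizontal : JoinedIn (orbitSet g K)ᶜ (p + lattice (1, -N))
      ((g ^ i) p + lattice (1, -N)) :=
    joinedIn_add (h.joinedIn_orbitSet hp ((zpow_apply_mem_orbitSet_iff i).2 hp)) fun z hz =>
      h.add_lattice_notMem_orbitSet hc (-N) hz
  have vertical : JoinedIn (orbitSet g K)ᶜ (p + lattice (1, -N - i * c)) (p + lattice (1, B)) := by
    refine joinedIn_vertical fun t ht hmem => ?_
    have hlow : p.2 + N ≤ t := by
      refine le_trans (le_min ?_ ?_) ht.1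
      · simpa using mod_cast hi
      · simpa using hBN.le
    have := (abs_le.1 (hb _ hmem (by simp))).2
    simp only at this
    linarith
  have image_vertical : JoinedIn (orbitSet g K)ᶜ ((g ^ i) p + lattice (1, -N))
      ((g ^ i) p + lattice (1, B + i * c)) := by
    have himage := (vertical.map (g ^ i).continuous).mono (V := (orbitSet g K)ᶜ) <|
      image_subset_iff.2 fun z hz => (zpow_apply_mem_orbitSet_iff i).not.2 hz
    simpa only [h.zpow_apply_add_lattice, mul_one, sub_add_cancel] using himage
  obtain ⟨z, hz, hz'⟩ := h.inter_orbitSet_nonempty (horizontal.trans image_vertical)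
    (fun z hz hzu => by
      have := (abs_le.1 (hb z hz (by simp [hzu]))).1
      simp only [Prod.snd_add, lattice_snd, Int.cast_neg, Int.cast_natCast]
      linarith)
    (fun z hz hzw => by
      have := (abs_le.1 (hb' z hz (by simp [hzw]))).2
      simp only [Prod.snd_add, lattice_snd, Int.cast_add, Int.cast_mul]
      linarith)
  exact hz' hz

end IsChain

end Chains

section RotationVector

theorem abs_quasiadditive_mul_sub_le {s : ℕ → ℝ} {D : ℝ} (hs : ∀ i j, |s (i + j) - s i - s j| ≤ D)
    (n m : ℕ) : |s ((n + 1) * m) - (n + 1) * s m| ≤ n * D := by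
  induction n with
  | zero => simp
  | succ n ih =>
    have hsplit := abs_add_le (s ((n + 1) * m + m) - s ((n + 1) * m) - s m)
      (s ((n + 1) * m) - (n + 1) * s m)
    rw [add_one_mul (n + 1) m]
    push_cast
    refine le_trans (le_of_eq ?_) (hsplit.trans ((add_le_add (hs _ _) ih).trans_eq ?_)) <;> ring_nf

theorem exists_linear_of_quasiadditive {s : ℕ → ℝ} {D : ℝ}
    (hs : ∀ i j, |s (i + j) - s i - s j| ≤ D) : ∃ ρ : ℝ, ∀ n : ℕ, |s n - n * ρ| ≤ D := by
  have hD : 0 ≤ D := (abs_nonneg _).trans (hs 0 0)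
  obtain ⟨ρ, hlower, hupper⟩ := exists_between_of_forall_le
    (range_nonempty fun m : ℕ => (s (m + 1) - D) / (m + 1))
    (range_nonempty fun n : ℕ => (s (n + 1) + D) / (n + 1)) (by
      rintro _ ⟨m, rfl⟩ _ ⟨n, rfl⟩
      have h₁ := (abs_le.1 (abs_quasiadditive_mul_sub_le hs n (m + 1))).1
      have h₂ := (abs_le.1 (abs_quasiadditive_mul_sub_le hs m (n + 1))).2
      rw [mul_comm (m + 1)] at h₂
      rw [div_le_div_iff₀ m.cast_add_one_pos n.cast_add_one_pos]
      linarith)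
  refine ⟨ρ, fun n => ?_⟩
  cases n with
  | zero => simpa using hs 0 0
  | succ n =>
    have hl := hlower (mem_range_self n)
    have hu := hupper (mem_range_self n)
    rw [div_le_iff₀ n.cast_add_one_pos] at hl
    rw [le_div_iff₀ n.cast_add_one_pos] at hu
    push_cast
    exact abs_le.2 ⟨by linarith, by linarith⟩

namespace IsChain

variable {Φ g : (ℝ × ℝ) ≃ₜ (ℝ × ℝ)} {α C η e : ℝ} {c : ℤ} {K : Set (ℝ × ℝ)} {z : ℝ × ℝ}

theorem crossing_unique_orbitSet (h : IsChain Φ α C g η e 0 K) {m k k' : ℤ} {x y : ℝ × ℝ}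
    (hx' : x ∈ orbitSet g K) (hx : x + lattice (m, k) ∈ orbitSet g K)
    (hy' : y ∈ orbitSet g K) (hy : y + lattice (m, k') ∈ orbitSet g K) : k = k' := by
  obtain ⟨i, hi⟩ := mem_orbitSet.1 hx
  obtain ⟨i', hi'⟩ := mem_orbitSet.1 hx'
  obtain ⟨j, hj⟩ := mem_orbitSet.1 hy
  obtain ⟨j', hj'⟩ := mem_orbitSet.1 hy'
  have h₁ := (zpow_apply_mem_piece_iff (i' - j') j).2 hj
  have h₂ := (zpow_apply_mem_piece_iff (i' - j') j').2 hj'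
  rw [h.zpow_apply_add_lattice, mul_zero, zero_mul, add_zero] at h₁
  rw [sub_add_cancel] at h₂
  exact h.crossing_unique hi hi' h₁ h₂ (by simpa using h.thickness_nonneg)

/-- A steep piece of the orbit of `K`, translated close to the origin, would cross the orbit at two
different heights. -/
theorem exists_oscillation_bound (h : IsChain Φ α C g η e 0 K) (R : ℝ) :
    ∃ D, ∀ u ∈ orbitSet g K, ∀ v ∈ orbitSet g K, |u.1 - v.1| ≤ R → u.2 - v.2 ≤ D := by
  obtain ⟨b, hb⟩ := h.exists_abs_snd_le (R + 1)
  refine ⟨2 * b + 2, fun u hu v hv huv => ?_⟩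
  by_contra! hlt
  have hm₁ := Int.floor_le v.1
  have hm₂ := Int.lt_floor_add_one v.1
  obtain ⟨huv₁, huv₂⟩ := abs_le.1 huv
  have crossing : ∀ k : ℤ, v.2 + b < k → k + b < u.2 →
      ∃ x ∈ orbitSet g K, x + lattice (⌊v.1⌋, k) ∈ orbitSet g K := by
    intro k hvk hku
    have hY : JoinedIn {x | x + lattice (⌊v.1⌋, k) ∈ orbitSet g K} (v + -lattice (⌊v.1⌋, k))
        (u + -lattice (⌊v.1⌋, k)) :=
      joinedIn_add (h.joinedIn_orbitSet hv hu) fun z hz => by simpa using hz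
    refine h.inter_orbitSet_nonempty hY (fun z hz hzv => ?_) (fun z hz hzu => ?_)
    · simp only [Prod.fst_add, Prod.fst_neg, lattice_fst, Prod.snd_add, Prod.snd_neg,
        lattice_snd] at hzv ⊢
      linarith [(abs_le.1 (hb z hz (abs_le.2 ⟨by linarith, by linarith⟩))).1]
    · simp only [Prod.fst_add, Prod.fst_neg, lattice_fst, Prod.snd_add, Prod.snd_neg,
        lattice_snd] at hzu ⊢
      linarith [(abs_le.1 (hb z hz (abs_le.2 ⟨by linarith, by linarith⟩))).2]
  have hk₁ := Int.floor_le (v.2 + b)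
  have hk₂ := Int.lt_floor_add_one (v.2 + b)
  obtain ⟨x, hx, hx'⟩ := crossing (⌊v.2 + b⌋ + 1) (by push_cast; linarith) (by push_cast; linarith)
  obtain ⟨y, hy, hy'⟩ := crossing (⌊v.2 + b⌋ + 2) (by push_cast; linarith) (by push_cast; linarith)
  have := h.crossing_unique_orbitSet hx hx' hy hy'
  lia

theorem exists_add_mem_orbitSet (h : IsChain Φ α C g η e c K) {j k₁ k₂ : ℤ}
    (h₁ : ∀ w ∈ orbitSet g K, w.1 = ((g ^ j) z).1 → ((g ^ j) z).2 + k₁ < w.2)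
    (h₂ : ∀ w ∈ orbitSet g K, w.1 = ((g ^ j) z).1 → w.2 < ((g ^ j) z).2 + k₂) :
    ∃ t ∈ uIcc (k₁ : ℝ) k₂, z + (0, t) ∈ orbitSet g K := by
  have lattice_vertical : ∀ k : ℤ, lattice (0, k) = (0, (k : ℝ)) := fun k =>
    Prod.ext Int.cast_zero rfl
  have segment : JoinedIn ((fun t : ℝ => z + (0, t)) '' uIcc (k₁ : ℝ) k₂) (z + lattice (0, k₁))
      (z + lattice (0, k₂)) := by
    rw [lattice_vertical, lattice_vertical]
    exact (((convex_uIcc _ _).isPathConnected nonempty_uIcc).joinedIn _ left_mem_uIcc _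
      right_mem_uIcc).map (f := fun t : ℝ => z + (0, t)) (by fun_prop)
  have himage := segment.map (g ^ j).continuous
  simp only [h.zpow_apply_add_lattice, mul_zero, add_zero] at himage
  obtain ⟨_, hw, _, ⟨t, ht, rfl⟩, rfl⟩ := h.inter_orbitSet_nonempty himage
    (fun w hw hwz => h₁ w hw (by simpa using hwz)) (fun w hw hwz => h₂ w hw (by simpa using hwz))
  exact ⟨t, ht, (zpow_apply_mem_orbitSet_iff j).1 hw⟩

theorem exists_shadow (h : IsChain Φ α C g η e c K) :
    ∃ L : ℕ, ∀ (j : ℤ), ∀ z ∈ Icc (0 : ℝ × ℝ) 1,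
      (∃ u ∈ orbitSet g K, u.1 = ((g ^ j) z).1 ∧ ((g ^ j) z).2 ≤ u.2 + L) ∧
      ∃ v ∈ orbitSet g K, v.1 = ((g ^ j) z).1 ∧ v.2 ≤ ((g ^ j) z).2 + L := by
  obtain ⟨b, hb⟩ := h.exists_abs_snd_le 1
  obtain ⟨L, hL⟩ := exists_nat_gt (b + 1)
  refine ⟨L, fun j z hz => ?_⟩
  obtain ⟨⟨hx₀, hy₀ : 0 ≤ z.2⟩, hx₁, hy₁ : z.2 ≤ 1⟩ := hz
  have hcolumn : ∀ t, z + (0, t) ∈ orbitSet g K → |z.2 + t| ≤ b := fun t ht =>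
    hb _ ht (by simpa using abs_le.2 ⟨neg_one_lt_zero.le.trans hx₀, hx₁⟩)
  obtain ⟨b', hb'⟩ := h.exists_abs_snd_le |((g ^ j) z).1|
  obtain ⟨N, hN⟩ := exists_nat_gt (max (L : ℝ) (b' + |((g ^ j) z).2|))
  obtain ⟨hLN, hN⟩ := max_lt_iff.1 hN
  obtain ⟨hgz₁, hgz₂⟩ := abs_le.1 (le_refl |((g ^ j) z).2|)
  constructor <;> by_contra! hcon
  · obtain ⟨t, ht, hmem⟩ := h.exists_add_mem_orbitSet (z := z) (j := j) (k₁ := -N) (k₂ := -L)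
      (fun w hw hwz => by push_cast; linarith [(abs_le.1 (hb' w hw (by rw [hwz]))).1])
      (fun w hw hwz => by push_cast; linarith [hcon w hw hwz])
    have htL : t ≤ -L := ht.2.trans (max_le (by push_cast; linarith) (by push_cast; rfl))
    linarith [(abs_le.1 (hcolumn t hmem)).1]
  · obtain ⟨t, ht, hmem⟩ := h.exists_add_mem_orbitSet (z := z) (j := j) (k₁ := L) (k₂ := N)
      (fun w hw hwz => by push_cast; linarith [hcon w hw hwz])
      (fun w hw hwz => by push_cast; linarith [(abs_le.1 (hb' w hw (by rw [hwz]))).2])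
    have htL : L ≤ t := (le_min (by push_cast; rfl) (by push_cast; linarith)).trans ht.1
    linarith [(abs_le.1 (hcolumn t hmem)).2]

theorem exists_mem_Icc_displacement_eq (h : IsChain Φ α C g η e 0 K) (j : ℤ) (z : ℝ × ℝ) :
    ∃ z' ∈ Icc (0 : ℝ × ℝ) 1, ((g ^ j) z).2 - z.2 = ((g ^ j) z').2 - z'.2 := by
  refine ⟨(Int.fract z.1, Int.fract z.2), ⟨⟨Int.fract_nonneg _, Int.fract_nonneg _⟩,
    (Int.fract_lt_one _).le, (Int.fract_lt_one _).le⟩, ?_⟩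
  have hz : z = (Int.fract z.1, Int.fract z.2) + lattice (⌊z.1⌋, ⌊z.2⌋) := by ext <;> simp
  conv_lhs => rw [hz, h.zpow_apply_add_lattice]
  simp only [mul_zero, zero_mul, add_zero, Prod.snd_add, lattice_snd]
  ring

theorem exists_displacement_bound (h : IsChain Φ α C g η e 0 K) :
    ∃ D, ∀ (j : ℤ) (z w : ℝ × ℝ), |((g ^ j) z).2 - z.2 - (((g ^ j) w).2 - w.2)| ≤ D := by
  obtain ⟨L, hL⟩ := h.exists_shadow
  obtain ⟨D, hD⟩ := h.exists_oscillation_bound (2 * C + 1)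
  have key : ∀ (j : ℤ) (z w : ℝ × ℝ),
      ((g ^ j) z).2 - z.2 - (((g ^ j) w).2 - w.2) ≤ D + 2 * L + 1 := by
    intro j z w
    obtain ⟨z', hz, hz'⟩ := h.exists_mem_Icc_displacement_eq j z
    obtain ⟨w', hw, hw'⟩ := h.exists_mem_Icc_displacement_eq j w
    obtain ⟨u, hu, hu₁, hu₂⟩ := (hL j z' hz).1
    obtain ⟨v, hv, hv₁, hv₂⟩ := (hL j w' hw).2
    obtain ⟨⟨hzx₀ : 0 ≤ z'.1, hzy₀ : 0 ≤ z'.2⟩, hzx₁ : z'.1 ≤ 1, -⟩ := hz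
    obtain ⟨⟨hwx₀ : 0 ≤ w'.1, -⟩, hwx₁ : w'.1 ≤ 1, hwy₁ : w'.2 ≤ 1⟩ := hw
    obtain ⟨hz₁, hz₂⟩ := abs_le.1 ((h.shift.zpow j).abs_fst_le h.bound z')
    obtain ⟨hw₁, hw₂⟩ := abs_le.1 ((h.shift.zpow j).abs_fst_le h.bound w')
    have := hD u hu v hv (abs_le.2 ⟨by linarith, by linarith⟩)
    linarith
  exact ⟨D + 2 * L + 1, fun j z w => abs_le.2 ⟨by linarith [key j w z], key j z w⟩⟩

theorem exists_rotation_vector (h : IsChain Φ α C g η e 0 K) :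
    ∃ (ρ : ℝ × ℝ) (D : ℝ), 0 < D ∧ ∀ (n : ℕ) (z : ℝ × ℝ), ‖(g ^ n) z - z - (n : ℝ) • ρ‖ ≤ D := by
  obtain ⟨D, hD⟩ := h.exists_displacement_bound
  obtain ⟨ρ, hρ⟩ := exists_linear_of_quasiadditive (s := fun n => ((g ^ n) 0).2) (D := D)
    fun i j => by
      have := hD i ((g ^ j) 0) 0
      rw [zpow_natCast, ← Homeomorph.mul_apply, ← pow_add, Prod.snd_zero, sub_zero] at this
      rwa [sub_right_comm]
  have hC := h.bound.nonneg
  have hD₀ : 0 ≤ D := (abs_nonneg _).trans (hD 0 0 0)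
  refine ⟨(η, ρ), 2 * D + C + 1, by linarith, fun n z => ?_⟩
  have hfst := (h.shift.zpow n).abs_fst_le h.bound z
  have hsnd := abs_add_le _ _ |>.trans (add_le_add (hD n z 0) (hρ n))
  rw [zpow_natCast] at hfst hsnd
  refine max_le ?_ ?_
  · simp only [Int.cast_natCast] at hfst
    simp only [Prod.fst_sub, Prod.smul_fst, smul_eq_mul, Real.norm_eq_abs]
    linarith
  · refine le_trans (le_of_eq ?_) (hsnd.trans (by linarith))
    simp only [Prod.snd_sub, Prod.smul_snd, smul_eq_mul, Real.norm_eq_abs, Prod.snd_zero]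
    ring_nf

end IsChain

end RotationVector

section Lifts

variable {f f' : T2 ≃ₜ T2} {F G : ℝ × ℝ → ℝ × ℝ} {Φ : (ℝ × ℝ) ≃ₜ (ℝ × ℝ)}
  {A : (ℤ × ℤ) ≃ₗ[ℤ] (ℤ × ℤ)}

theorem isEmbedding_lattice : IsEmbedding lattice :=
  Int.isClosedEmbedding_coe_real.isEmbedding.prodMap Int.isClosedEmbedding_coe_real.isEmbedding

theorem isOpenQuotientMap_proj : IsOpenQuotientMap proj :=
  QuotientAddGroup.isOpenQuotientMap_mk.prodMap QuotientAddGroup.isOpenQuotientMap_mk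

theorem proj_add (z w : ℝ × ℝ) : proj (z + w) = proj z + proj w := rfl

theorem proj_lattice (v : ℤ × ℤ) : proj (lattice v) = 0 := by
  have coe_int : ∀ n : ℤ, ((n : ℝ) : UnitAddCircle) = 0 := fun n =>
    (AddCircle.coe_eq_zero_iff 1).2 ⟨n, zsmul_one n⟩
  exact Prod.ext (coe_int v.1) (coe_int v.2)

theorem proj_add_lattice (z : ℝ × ℝ) (v : ℤ × ℤ) : proj (z + lattice v) = proj z := by
  rw [proj_add, proj_lattice, add_zero]

theorem exists_eq_add_lattice_of_proj_eq {z w : ℝ × ℝ} (h : proj z = proj w) :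
    ∃ v, z = w + lattice v := by
  have exists_int : ∀ {x y : ℝ}, (x : UnitAddCircle) = y → ∃ n : ℤ, x = y + n := fun {x y} hxy => by
    obtain ⟨n, hn⟩ := (AddCircle.coe_eq_zero_iff 1).1 (sub_eq_zero.2 hxy)
    exact ⟨n, by rw [← zsmul_one n, hn, add_sub_cancel]⟩
  obtain ⟨m, hm⟩ := exists_int (congrArg Prod.fst h)
  obtain ⟨k, hk⟩ := exists_int (congrArg Prod.snd h)
  exact ⟨(m, k), Prod.ext hm hk⟩

theorem exists_forall_eq_add_lattice {X : Type*} [TopologicalSpace X] [PreconnectedSpace X]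
    [Nonempty X] {u u' : X → ℝ × ℝ} (hu : Continuous u) (hu' : Continuous u')
    (h : ∀ x, proj (u x) = proj (u' x)) : ∃ v, ∀ x, u x = u' x + lattice v := by
  choose v hv using fun x => exists_eq_add_lattice_of_proj_eq (h x)
  have hcont : Continuous v := by
    rw [isEmbedding_lattice.continuous_iff]
    exact (hu.sub hu').congr fun x => sub_eq_of_eq_add' (hv x)
  obtain ⟨x₀⟩ := ‹Nonempty X›
  exact ⟨v x₀, fun x => PreconnectedSpace.constant inferInstance hcont ▸ hv x⟩

theorem exists_continuousMap_proj {Y : Type*} [TopologicalSpace Y] {u : ℝ × ℝ → Y}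
    (hu : Continuous u) (h : ∀ z v, u (z + lattice v) = u z) :
    ∃ U : C(T2, Y), ∀ z, U (proj z) = u z := by
  let p : C(ℝ × ℝ, T2) := ⟨proj, isOpenQuotientMap_proj.continuous⟩
  have hp : IsQuotientMap p := isOpenQuotientMap_proj.isQuotientMap
  have hfactors : Function.FactorsThrough u p := fun z w hzw => by
    obtain ⟨v, rfl⟩ := exists_eq_add_lattice_of_proj_eq hzw
    exact h w v
  exact ⟨hp.lift ⟨u, hu⟩ hfactors, DFunLike.congr_fun (hp.lift_comp ⟨u, hu⟩ hfactors)⟩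

theorem exists_isLift (f : T2 ≃ₜ T2) : ∃ F, IsLift F f := by
  have exists_real_lift : ∀ u : C(ℝ × ℝ, UnitAddCircle), ∃ U : C(ℝ × ℝ, ℝ), ∀ z, U z = u z := by
    intro u
    obtain ⟨e, he⟩ := QuotientAddGroup.mk_surjective (u 0)
    obtain ⟨U, ⟨-, hU⟩, -⟩ :=
      (AddCircle.isCoveringMap_coe (1 : ℝ)).existsUnique_continuousMap_lifts u 0 e he
    exact ⟨U, congrFun hU⟩
  have hp := isOpenQuotientMap_proj.continuous
  obtain ⟨U, hU⟩ := exists_real_lift ⟨fun z => (f (proj z)).1, by fun_prop⟩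
  obtain ⟨V, hV⟩ := exists_real_lift ⟨fun z => (f (proj z)).2, by fun_prop⟩
  exact ⟨fun z => (U z, V z), by fun_prop, fun z => Prod.ext (hU z) (hV z)⟩

theorem isLift_addRight_lattice (v : ℤ × ℤ) : IsLift (Homeomorph.addRight (lattice v)) 1 :=
  ⟨(Homeomorph.addRight _).continuous, fun z => proj_add_lattice z v⟩

theorem IsLift.comp (hF : IsLift F f) (hG : IsLift G f') : IsLift (F ∘ G) (f * f') :=
  ⟨hF.1.comp hG.1, fun z => by
    rw [Function.comp_apply, hF.2, hG.2, Homeomorph.mul_apply]⟩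

theorem IsLift.pow (hΦ : IsLift Φ f) (n : ℕ) : IsLift ⇑(Φ ^ n) (f ^ n) := by
  induction n with
  | zero => exact ⟨continuous_id, fun _ => rfl⟩
  | succ n ih => exact ih.comp hΦ

theorem IsLift.exists_eq_add_lattice (hF : IsLift F f) (hG : IsLift G f) :
    ∃ v, ∀ z, F z = G z + lattice v :=
  exists_forall_eq_add_lattice hF.1 hG.1 fun z => by rw [hF.2, hG.2]

theorem IsLift.exists_homeomorph (hF : IsLift F f) : ∃ Φ : (ℝ × ℝ) ≃ₜ (ℝ × ℝ), ⇑Φ = F := by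
  obtain ⟨G, hG⟩ := exists_isLift f⁻¹
  have hid : IsLift id (f * f⁻¹) := ⟨continuous_id, fun z => by simp⟩
  have hid' : IsLift id (f⁻¹ * f) := ⟨continuous_id, fun z => by simp⟩
  obtain ⟨v, hFG : ∀ z, F (G z) = z + lattice v⟩ := (hF.comp hG).exists_eq_add_lattice hid
  obtain ⟨w, hGF : ∀ z, G (F z) = z + lattice w⟩ := (hG.comp hF).exists_eq_add_lattice hid'
  have hright : Function.RightInverse (fun z => G (z - lattice v)) F := fun z => by
    rw [hFG, sub_add_cancel]
  have hinj : Function.Injective F := fun x y hxy =>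
    add_right_cancel ((hGF x).symm.trans ((congrArg G hxy).trans (hGF y)))
  exact ⟨{ toFun := F
           invFun := fun z => G (z - lattice v)
           left_inv := hright.leftInverse_of_injective hinj
           right_inv := hright
           continuous_toFun := hF.1
           continuous_invFun := hG.1.comp (continuous_sub_right _) }, rfl⟩

theorem IsLift.exists_linearMap (hF : IsLift F f) :
    ∃ L : (ℤ × ℤ) →ₗ[ℤ] (ℤ × ℤ), ∀ z v, F (z + lattice v) = F z + lattice (L v) := by
  have exists_value : ∀ v, ∃ w, ∀ z, F (z + lattice v) = F z + lattice w := fun v =>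
    exists_forall_eq_add_lattice (hF.1.comp (continuous_add_const (lattice v))) hF.1 fun z => by
      rw [hF.2, hF.2, proj_add_lattice]
  choose L hL using exists_value
  have hadd : ∀ v w, L (v + w) = L v + L w := fun v w => isEmbedding_lattice.injective <| by
    have h := hL (v + w) 0
    rw [map_add, add_comm (lattice v), ← add_assoc, hL, hL, add_assoc] at h
    rw [← add_left_cancel h, map_add, add_comm]
  exact ⟨(AddMonoidHom.mk' L hadd).toIntLinearMap, fun z v => hL v z⟩

theorem IsLift.exists_isDeckEquivariant (hΦ : IsLift Φ f) : ∃ A, IsDeckEquivariant Φ A := by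
  have hsymm : IsLift Φ.symm f.symm := ⟨Φ.symm.continuous, fun z => by
    rw [f.eq_symm_apply, ← hΦ.2, Φ.apply_symm_apply]⟩
  obtain ⟨L, hL⟩ := hΦ.exists_linearMap
  obtain ⟨L', hL'⟩ := hsymm.exists_linearMap
  have hLL' : ∀ v, L (L' v) = v := fun v => isEmbedding_lattice.injective <| by
    have h := hL (Φ.symm 0) (L' v)
    rw [← hL', Φ.apply_symm_apply, Φ.apply_symm_apply] at h
    exact (add_left_cancel h).symm
  have hL'L : ∀ v, L' (L v) = v := fun v => isEmbedding_lattice.injective <| by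
    have h := hL' (Φ 0) (L v)
    rw [← hL, Φ.symm_apply_apply, Φ.symm_apply_apply] at h
    exact (add_left_cancel h).symm
  exact ⟨LinearEquiv.ofLinearMap L L' (LinearMap.ext hLL') (LinearMap.ext hL'L), hL⟩

theorem homotopic_id_of_isDeckEquivariant_one (hΦ : IsLift Φ f) (h : IsDeckEquivariant Φ 1) :
    ContinuousMap.Homotopic (f : C(T2, T2)) (ContinuousMap.id T2) := by
  obtain ⟨D, hD⟩ := exists_continuousMap_proj (u := fun z => Φ z - z) (by fun_prop) fun z v => by
    rw [h, LinearEquiv.coe_one, id, add_sub_add_right_eq_sub]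
  have hp := isOpenQuotientMap_proj.continuous
  refine ⟨{ toFun := fun q => q.2 + proj ((1 - (q.1 : ℝ)) • D q.2)
            continuous_toFun := by fun_prop
            map_zero_left := fun q => ?_
            map_one_left := fun q => ?_ }⟩
  · obtain ⟨z, rfl⟩ := isOpenQuotientMap_proj.surjective q
    simp only [Icc.coe_zero, sub_zero, one_smul, hD]
    rw [← proj_add, add_sub_cancel, hΦ.2]
    rfl
  · simp only [Icc.coe_one, sub_self, zero_smul]
    exact add_zero q

theorem homeomorph_pow_apply {X : Type*} [TopologicalSpace X] (Ψ : X ≃ₜ X) (n : ℕ) (x : X) :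
    (Ψ ^ n) x = Ψ^[n] x :=
  congrFun (hom_coe_pow (fun Ψ : X ≃ₜ X => ⇑Ψ) rfl (fun _ _ => rfl) Ψ n) x

theorem hasHorizontalBound_of_forall_nat {α C : ℝ}
    (h : ∀ (n : ℕ) z, |((Φ ^ n) z).1 - z.1 - n * α| ≤ C) : HasHorizontalBound Φ α C := by
  intro n z
  obtain ⟨k, rfl | rfl⟩ := n.eq_nat_or_neg
  · simpa using h k z
  · have hinv : (Φ ^ k) ((Φ ^ (-(k : ℤ))) z) = z := by
      rw [← zpow_natCast, ← Homeomorph.mul_apply, ← zpow_add, add_neg_cancel, zpow_zero,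
        Homeomorph.one_apply]
    have hk := h k ((Φ ^ (-(k : ℤ))) z)
    rw [hinv, ← abs_neg] at hk
    convert hk using 2
    push_cast
    ring

end Lifts

section Speed

variable {F : ℝ × ℝ → ℝ × ℝ} {f : T2 ≃ₜ T2} {Ψ : (ℝ × ℝ) ≃ₜ (ℝ × ℝ)}
  {A : (ℤ × ℤ) ≃ₗ[ℤ] (ℤ × ℤ)} {α C : ℝ}

theorem exists_mul_self_eq_shear (hA : ∀ v, (A v).1 = v.1) : ∃ c, A * A = shear c := by
  have hA' : ∀ v, (A.symm v).1 = v.1 := fun v => by rw [← hA, A.apply_symm_apply]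
  obtain ⟨d, hd⟩ : ∃ d, A (0, 1) = (0, d) := ⟨(A (0, 1)).2, Prod.ext (hA _) rfl⟩
  obtain ⟨d', hd'⟩ : ∃ d', A.symm (0, 1) = (0, d') :=
    ⟨(A.symm (0, 1)).2, Prod.ext (hA' _) rfl⟩
  obtain ⟨c, hc⟩ : ∃ c, A (1, 0) = (1, c) := ⟨(A (1, 0)).2, Prod.ext (hA _) rfl⟩
  have hA_apply : ∀ m k : ℤ, A (m, k) = (m, c * m + d * k) := fun m k => by
    have hmk : ((m, k) : ℤ × ℤ) = m • (1, 0) + k • (0, 1) := by ext <;> simp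
    rw [hmk, map_add, map_zsmul, map_zsmul, hd, hc]
    ext <;> simp [mul_comm]
  have hdd : d * d = 1 := by
    have h := A.apply_symm_apply (0, 1)
    rw [hd', hA_apply, mul_zero, zero_add, Prod.mk.injEq] at h
    rcases Int.isUnit_iff.1 (IsUnit.of_mul_eq_one d' h.2) with rfl | rfl <;> rfl
  refine ⟨c + d * c, LinearEquiv.ext fun ⟨m, k⟩ => ?_⟩
  rw [LinearEquiv.mul_apply, hA_apply, hA_apply, shear_apply, Prod.mk.injEq]
  exact ⟨rfl, by linear_combination k * hdd⟩

theorem IsDeckEquivariant.exists_forall_pow_displacement_le (h : IsDeckEquivariant Ψ 1) :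
    ∃ B, ∀ (n : ℕ) z, |((Ψ ^ n) z).2 - z.2| ≤ n * B := by
  obtain ⟨D, hD⟩ := exists_continuousMap_proj (u := fun z => (Ψ z).2 - z.2) (by fun_prop)
    fun z v => by
      rw [h, LinearEquiv.coe_one, id, Prod.snd_add, Prod.snd_add, add_sub_add_right_eq_sub]
  refine ⟨‖D‖, fun n z => ?_⟩
  induction n with
  | zero => simp
  | succ n ih =>
    have hstep := D.norm_coe_le_norm (proj ((Ψ ^ n) z))
    rw [hD, Real.norm_eq_abs] at hstep
    rw [pow_succ', Homeomorph.mul_apply, Nat.cast_succ, add_one_mul, add_comm (_ * _)]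
    exact (abs_sub_le _ _ _).trans (add_le_add hstep ih)

/-- The vertical displacement of `Ψ ^ n` changes by multiples of `n * c` under horizontal integer
translations, hence can be made small. -/
theorem IsDeckEquivariant.exists_pow_displacement_le {c : ℤ} (h : IsDeckEquivariant Ψ (shear c))
    (hc : c ≠ 0) (n : ℕ) : ∃ z, |((Ψ ^ n) z).2 - z.2| ≤ n * |(c : ℝ)| := by
  rcases n.eq_zero_or_pos with rfl | hn
  · exact ⟨0, by simp⟩
  set y := ((Ψ ^ n) 0).2
  have ht : (n : ℝ) * c ≠ 0 := mul_ne_zero (mod_cast hn.ne') (mod_cast hc)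
  refine ⟨0 + lattice (-round (y / (n * c)), 0), ?_⟩
  have hdispl : ((Ψ ^ n) (0 + lattice (-round (y / (n * c)), 0))).2
      - (0 + lattice (-round (y / (n * c)), 0)).2
      = n * c * (y / (n * c) - round (y / (n * c))) := by
    rw [← zpow_natCast, h.zpow, shear_zpow, shear_apply, mul_sub, mul_div_cancel₀ _ ht]
    simp [y, sub_eq_add_neg]
  rw [hdispl, abs_mul, abs_mul, Nat.abs_cast]
  exact mul_le_of_le_one_right (by positivity) ((abs_sub_round _).trans (by norm_num))

theorem exists_mem_rotationSet_fst_eq {B : ℝ}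
    (hC : ∀ (n : ℕ) z, |(F^[n] z - z).1 - n * α| ≤ C)
    (hB : ∀ N : ℕ, ∃ n ≥ N, ∃ z, |(F^[n] z - z).2| ≤ n * B) : ∃ ρ ∈ rotationSet F, ρ.1 = α := by
  choose n hn z hz using fun N => hB (N + 1)
  have hpos : ∀ N, (0 : ℝ) < n N := fun N => Nat.cast_pos.2 (N.succ_pos.trans_le (hn N))
  set x : ℕ → ℝ × ℝ := fun N => (n N : ℝ)⁻¹ • (F^[n N] (z N) - z N)
  have hx_fst : Filter.Tendsto (fun N => (x N).1) Filter.atTop (𝓝 α) := by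
    rw [tendsto_iff_dist_tendsto_zero]
    refine squeeze_zero (fun _ => dist_nonneg) (fun N => ?_)
      ((tendsto_const_div_atTop_nhds_zero_nat C).comp
        (Filter.tendsto_atTop_mono (fun N => N.le_succ.trans (hn N)) Filter.tendsto_id))
    have hx : (x N).1 - α = ((F^[n N] (z N) - z N).1 - n N * α) / n N := by
      rw [sub_div, mul_div_cancel_left₀ _ (hpos N).ne', div_eq_inv_mul]
      rfl
    rw [Real.dist_eq, hx, abs_div, Nat.abs_cast]
    exact div_le_div_of_nonneg_right (hC _ _) (hpos N).le
  have hx_snd : ∀ N, (x N).2 ∈ Icc (-B) B := fun N => by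
    refine abs_le.1 ?_
    rw [Prod.smul_snd, smul_eq_mul, abs_mul, abs_inv, Nat.abs_cast,
      inv_mul_le_iff₀ (hpos N)]
    exact hz N
  obtain ⟨y, -, φ, hφ, hy⟩ := isCompact_Icc.tendsto_subseq hx_snd
  refine ⟨(α, y), mem_iInter.2 fun m => ?_, rfl⟩
  refine mem_closure_of_tendsto ((hx_fst.comp hφ.tendsto_atTop).prodMk_nhds hy) ?_
  filter_upwards [Filter.eventually_ge_atTop m] with k hk
  exact mem_iUnion₂.2 ⟨n (φ k), hk.trans ((hφ.le_apply.trans (φ k).le_succ).trans (hn _)),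
    z (φ k), rfl⟩

theorem IsLift.exists_mem_rotationSet_fst_eq (hF : IsLift F f)
    (hC : ∀ (n : ℕ) z, |(F^[n] z - z).1 - n * α| ≤ C) : ∃ ρ ∈ rotationSet F, ρ.1 = α := by
  obtain ⟨Φ, rfl⟩ := hF.exists_homeomorph
  obtain ⟨A, hA⟩ := hF.exists_isDeckEquivariant
  obtain ⟨c, hc⟩ := exists_mul_self_eq_shear
    (hA.fst_apply (t := α) (B := C) fun z => by simpa using hC 1 z)
  have hsq : IsDeckEquivariant (Φ * Φ) (shear c) := hc ▸ hA.mul hA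
  obtain ⟨B, hB⟩ : ∃ B, ∀ n : ℕ, ∃ z, |(((Φ * Φ) ^ n) z).2 - z.2| ≤ n * B := by
    rcases eq_or_ne c 0 with rfl | hc
    · obtain ⟨B, hB⟩ := (shear_zero ▸ hsq).exists_forall_pow_displacement_le
      exact ⟨B, fun n => ⟨0, hB n 0⟩⟩
    · exact ⟨_, hsq.exists_pow_displacement_le hc⟩
  refine TorusRotationFactor.exists_mem_rotationSet_fst_eq hC (B := |B|) fun N =>
    ⟨2 * N, by lia, (hB N).imp fun z hz => ?_⟩
  rw [← pow_two, ← pow_mul, homeomorph_pow_apply] at hz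
  have hN : (N : ℝ) ≤ (2 * N : ℕ) := mod_cast (by lia)
  exact (hz.trans (mul_le_mul_of_nonneg_left (le_abs_self B) N.cast_nonneg)).trans
    (mul_le_mul_of_nonneg_right hN (abs_nonneg B))

theorem IsLift.exists_abs_sub_mul_le (hF : IsLift F f) (hrot : rotationSet F ⊆ {α} ×ˢ univ)
    (hdev : HasBoundedDeviations F (1, 0)) :
    ∃ C, ∀ (n : ℕ) z, |(F^[n] z - z).1 - n * α| ≤ C := by
  obtain ⟨a, -, C, -, hC⟩ := hdev
  simp only [dot, mul_one, mul_zero, add_zero] at hC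
  obtain ⟨ρ, hρ, rfl⟩ := hF.exists_mem_rotationSet_fst_eq hC
  obtain ⟨rfl, -⟩ := hrot hρ
  exact ⟨C, hC⟩

end Speed

section Semiconjugacy

variable {f : T2 ≃ₜ T2} {Φ : (ℝ × ℝ) ≃ₜ (ℝ × ℝ)} {A : (ℤ × ℤ) ≃ₗ[ℤ] (ℤ × ℤ)}
  {α C r s r' s' : ℝ}

theorem isSemiconjugateToRotation_of_continuous_level (hf : IsLift Φ f)
    (hb : HasHorizontalBound Φ α C) (hΦ : IsDeckEquivariant Φ A)
    (hcont : Continuous (level Φ α C)) : IsSemiconjugateToRotation f α := by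
  have level_add : ∀ z v, level Φ α C (z + lattice v) = level Φ α C z + v.1 := fun z v =>
    (isShift_addRight_lattice hb hΦ v).level_apply hb z
  obtain ⟨h, hh⟩ := exists_continuousMap_proj (u := fun z => ((level Φ α C z : ℝ) : T1))
    ((AddCircle.continuous_mk' 1).comp hcont) fun z v => by
      rw [level_add, AddCircle.coe_add,
        (AddCircle.coe_eq_zero_iff (1 : ℝ) (x := (v.1 : ℝ))).2 ⟨v.1, zsmul_one _⟩, add_zero]
  refine ⟨h, h.continuous, fun θ => ?_, fun q => ?_⟩
  · obtain ⟨x, rfl⟩ := QuotientAddGroup.mk_surjective θ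
    obtain ⟨z, rfl⟩ : x ∈ range (level Φ α C) := by
      refine mem_range_of_exists_le_of_exists_ge hcont
        ⟨0 + lattice (⌊x - level Φ α C 0⌋, 0), ?_⟩ ⟨0 + lattice (⌈x - level Φ α C 0⌉, 0), ?_⟩
      · linarith [level_add 0 (⌊x - level Φ α C 0⌋, 0), Int.floor_le (x - level Φ α C 0)]
      · linarith [level_add 0 (⌈x - level Φ α C 0⌉, 0), Int.le_ceil (x - level Φ α C 0)]
    exact ⟨proj z, hh z⟩
  · obtain ⟨z, rfl⟩ := isOpenQuotientMap_proj.surjective q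
    rw [← hf.2, hh, hh, isShift_self.level_apply hb, AddCircle.coe_add]

/-- The shifts have dense translation amounts, so some shift carries one strip into the other. -/
theorem HasEssentialCurve.strip_of_sub_lt (hb : HasHorizontalBound Φ α C)
    (hΦ : IsDeckEquivariant Φ A) (hα : Irrational α) (h : HasEssentialCurve (strip Φ α C r s))
    (hlt : s - r < s' - r') : HasEssentialCurve (strip Φ α C r' s') := by
  obtain ⟨p, l, hl, hp⟩ := h
  obtain ⟨t, ⟨ht, ht'⟩, Ψ, B, hB, hΨ⟩ := exists_isShift (x := r' - r) (y := s' - s) hb hΦ hα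
    (by linarith)
  have hBl : B (0, l) = (0, (B (0, l)).2) :=
    Prod.ext (hB.fst_apply (hΨ.abs_fst_le hb) (0, l)) rfl
  refine ⟨Ψ p, (B (0, l)).2, fun h₀ => hl ?_, ?_⟩
  · have hB_zero : B (0, l) = 0 := hBl.trans (congrArg (Prod.mk 0) h₀)
    exact congrArg Prod.snd ((LinearEquiv.map_eq_zero_iff B).1 hB_zero)
  · have hmem : ∀ z ∈ strip Φ α C r s, Ψ z ∈ strip Φ α C r' s' := fun z hz =>
      strip_mono hb (by linarith) (by linarith) ((hΨ.mem_strip_iff hb r s z).1 hz)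
    rw [← hBl, ← hB]
    exact (hp.map Ψ.continuous).mono (image_subset_iff.2 hmem)

end Semiconjugacy

section PseudoRotation

variable {f : T2 ≃ₜ T2} {Φ Ψ : (ℝ × ℝ) ≃ₜ (ℝ × ℝ)} {A : (ℤ × ℤ) ≃ₗ[ℤ] (ℤ × ℤ)}
  {α C e r s t : ℝ}

theorem exists_return_segment_subset (hnw : IsNonwandering f) (hf : IsLift Φ f) {U : Set (ℝ × ℝ)}
    (hU : IsOpen U) (hne : U.Nonempty) : ∃ n : ℕ, 1 ≤ n ∧ ∃ v z,
      segment ℝ z ((Homeomorph.addRight (lattice v) * Φ ^ n) z) ⊆ U := by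
  obtain ⟨x, hx⟩ := hne
  obtain ⟨ε, hε, hball⟩ := Metric.isOpen_iff.1 hU x hx
  obtain ⟨n, hn, _, ⟨_, ⟨z, hz, rfl⟩, hzw⟩, ⟨w, hw, rfl⟩⟩ := hnw (proj '' Metric.ball x ε)
    (isOpenQuotientMap_proj.isOpenMap _ Metric.isOpen_ball)
    ((Metric.nonempty_ball.2 hε).image proj)
  obtain ⟨v, hv⟩ : ∃ v, w = (Φ ^ n) z + lattice v :=
    exists_eq_add_lattice_of_proj_eq (hzw.symm.trans ((hf.pow n).2 z).symm)
  refine ⟨n, hn, v, z, ((convex_ball x ε).segment_subset hz ?_).trans hball⟩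
  rwa [show (Homeomorph.addRight (lattice v) * Φ ^ n) z = w from hv.symm]

theorem IsShift.abs_lt_of_mem_strip (hb : HasHorizontalBound Φ α C) (hΨ : IsShift Φ α Ψ t)
    {z : ℝ × ℝ} (hz : z ∈ strip Φ α C r s) (hΨz : Ψ z ∈ strip Φ α C r s) : |t| < s - r := by
  have h := (hΨ.mem_strip_iff hb r s z).1 hz
  have h₁ : r < s + t := lt_of_mem_strip ⟨h.1, hΨz.2⟩
  have h₂ : r + t < s := lt_of_mem_strip ⟨hΨz.1, h.2⟩
  exact abs_lt.2 ⟨by linarith, by linarith⟩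

/-- Passing to the square of `Ψ` makes its action on `ℤ²` a shear. -/
theorem exists_isChain_of_segment_subset (hb : HasHorizontalBound Φ α C)
    (hΦ : IsDeckEquivariant Φ A) {B : (ℤ × ℤ) ≃ₗ[ℤ] (ℤ × ℤ)} (hB : IsDeckEquivariant Ψ B)
    (hΨ : IsShift Φ α Ψ t) (ht : t ≠ 0) {z : ℝ × ℝ}
    (hz : segment ℝ z (Ψ z) ⊆ strip Φ α C (-(e / 4)) (e / 4))
    (hess : ∀ r, ¬ HasEssentialCurve (strip Φ α C (r - 4 * e) (r + 4 * e))) :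
    ∃ c K, IsChain Φ α C (Ψ * Ψ) (t + t) e c K := by
  obtain ⟨c, hc⟩ := exists_mul_self_eq_shear (hB.fst_apply (hΨ.abs_fst_le hb))
  set S := segment ℝ z (Ψ z) with hS
  have hzS : z ∈ S := left_mem_segment ℝ z (Ψ z)
  have hΨzS : Ψ z ∈ S := right_mem_segment ℝ z (Ψ z)
  have ht_lt := abs_lt.1 (hΨ.abs_lt_of_mem_strip hb (hz hzS) (hz hΨzS))
  have hS_compact : IsCompact S := by
    rw [hS, segment_eq_image_lineMap]
    exact isCompact_Icc.image AffineMap.lineMap_continuous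
  have hS_path : IsPathConnected S := (convex_segment z (Ψ z)).isPathConnected ⟨z, hzS⟩
  exact ⟨c, S ∪ Ψ '' S,
    { bound := hb
      translation := isShift_addRight_lattice hb hΦ
      equivariant := hc ▸ hB.mul hB
      shift := hΨ.mul hΨ
      shift_ne := fun h₀ => ht (by linarith)
      shift_le := abs_le.2 ⟨by linarith, by linarith⟩
      compact := hS_compact.union (hS_compact.image Ψ.continuous)
      pathConnected := hS_path.union (hS_path.image Ψ.continuous)
        ⟨Ψ z, hΨzS, mem_image_of_mem Ψ hzS⟩
      meets := ⟨Ψ (Ψ z), .inr (mem_image_of_mem Ψ hΨzS), z, .inl hzS, rfl⟩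
      subset := by
        refine union_subset (hz.trans (strip_mono hb (by linarith) (by linarith))) ?_
        rintro _ ⟨u, hu, rfl⟩
        exact strip_mono hb (by linarith) (by linarith) ((hΨ.mem_strip_iff hb _ _ u).1 (hz hu))
      not_essential := hess }⟩

theorem exists_isPseudoRotationBdd (hnw : IsNonwandering f) (hf : IsLift Φ f)
    (hb : HasHorizontalBound Φ α C) (hΦ : IsDeckEquivariant Φ A) (hα : Irrational α)
    (hrs : r < s) (hess : ¬ HasEssentialCurve (strip Φ α C r s)) :
    ∃ k : ℕ, 1 ≤ k ∧ IsPseudoRotationBdd (f ^ k) := by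
  obtain ⟨e, he, hers⟩ : ∃ e, 0 < e ∧ 8 * e < s - r := ⟨(s - r) / 16, by linarith, by linarith⟩
  have hthin : ∀ u, ¬ HasEssentialCurve (strip Φ α C (u - 4 * e) (u + 4 * e)) := fun u hu =>
    hess (hu.strip_of_sub_lt hb hΦ hα (by linarith))
  obtain ⟨n, hn, v, z, hz⟩ := exists_return_segment_subset hnw hf (isOpen_strip _ _)
    (strip_nonempty hb hΦ hα (show -(e / 4) < e / 4 by linarith))
  set Ψ := Homeomorph.addRight (lattice v) * Φ ^ n with hΨ
  have hΨ_shift : IsShift Φ α Ψ (v.1 + n * α) := by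
    simpa using (isShift_addRight_lattice hb hΦ v).mul (isShift_self.zpow n)
  have hΨ_equiv : IsDeckEquivariant Ψ (1 * A ^ (n : ℤ)) :=
    (isDeckEquivariant_addRight _).mul (by simpa using hΦ.zpow n)
  have hΨ_lift : IsLift Ψ (f ^ n) := by
    rw [← one_mul (f ^ n), hΨ]
    exact (isLift_addRight_lattice v).comp (hf.pow n)
  have hne : (v.1 + n * α : ℝ) ≠ 0 := ((hα.natCast_mul (by lia)).intCast_add _).ne_zero
  obtain ⟨c, K, hK⟩ := exists_isChain_of_segment_subset hb hΦ hΨ_equiv hΨ_shift hne hz hthin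
  obtain rfl := hK.twist_eq_zero
  obtain ⟨ρ, D, hD, hρ⟩ := hK.exists_rotation_vector
  have hlift : IsLift ⇑(Ψ * Ψ) (f ^ (n + n)) := by
    rw [pow_add]
    exact hΨ_lift.comp hΨ_lift
  refine ⟨n + n, by lia, homotopic_id_of_isDeckEquivariant_one hlift ?_,
    ⇑(Ψ * Ψ : (ℝ × ℝ) ≃ₜ (ℝ × ℝ)), ρ, D, hlift, hD, fun j u => ?_⟩
  · rw [← shear_zero]
    exact hK.equivariant
  · rw [← homeomorph_pow_apply]
    exact hρ j u

end PseudoRotation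

end TorusRotationFactor

theorem theorem2_general
    (f : TorusRotationFactor.T2 ≃ₜ TorusRotationFactor.T2)
    (F : ℝ × ℝ → ℝ × ℝ) (hF : TorusRotationFactor.IsLift F f)
    (hnw : TorusRotationFactor.IsNonwandering f)
    (α : ℝ) (hα : Irrational α) (C : ℝ)
    (hC : ∀ (n : ℕ) (z : ℝ × ℝ), |(F^[n] z - z).1 - n * α| ≤ C)
    (hpr : ∀ k : ℕ, 1 ≤ k → ¬ TorusRotationFactor.IsPseudoRotationBdd (f ^ k)) :
    TorusRotationFactor.IsSemiconjugateToRotation f α := by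
  open TorusRotationFactor in
  obtain ⟨Φ, rfl⟩ := hF.exists_homeomorph
  obtain ⟨A, hA⟩ := hF.exists_isDeckEquivariant
  have hb : HasHorizontalBound Φ α C := hasHorizontalBound_of_forall_nat fun n z => by
    rw [homeomorph_pow_apply]
    exact hC n z
  by_cases hess : ∀ r s, r < s → HasEssentialCurve (strip Φ α C r s)
  · exact isSemiconjugateToRotation_of_continuous_level hF hb hA (continuous_level hb hA hess)
  · push Not at hess
    obtain ⟨r, s, hrs, hno⟩ := hess
    obtain ⟨k, hk, hps⟩ := exists_isPseudoRotationBdd hnw hF hb hA hα hrs hno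
    exact absurd hps (hpr k hk)

theorem theorem2
    (f : TorusRotationFactor.T2 ≃ₜ TorusRotationFactor.T2)
    (F : ℝ × ℝ → ℝ × ℝ) (hF : TorusRotationFactor.IsLift F f)
    (hnw : TorusRotationFactor.IsNonwandering f)
    (hna : ¬ TorusRotationFactor.IsEventuallyAnnular f)
    (α : ℝ) (hα : Irrational α)
    (hrot : TorusRotationFactor.rotationSet F ⊆ {α} ×ˢ Set.univ)
    (hdev : TorusRotationFactor.HasBoundedDeviations F (1, 0))
    (hpr : ∀ k : ℕ, 1 ≤ k → ¬ TorusRotationFactor.IsPseudoRotationBdd (f ^ k)) :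
    TorusRotationFactor.IsSemiconjugateToRotation f α := by
  obtain ⟨C, hC⟩ := hF.exists_abs_sub_mul_le hrot hdev
  exact theorem2_general f F hF hnw α hα C hC hpr
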